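/- Let $\alpha_1,A_1,\gamma_2>0$ and consider the system of rational difference equations $$x_{n+1}=\frac{\alpha_1}{A_1+y_n},\qquad y_{n+1}=\frac{\gamma_2y_n}{x_n},\qquad n=0,1,2,\dots,$$ with arbitrary initial conditions $x_0,y_0\ge 0$ for which no denominator ever vanishes. Its equilibria are the fixed points of the map $T(x,y)=(\alpha_1/(A_1+y),\,\gamma_2y/x)$; a saddle point is an equilibrium at which one eigenvalue of the Jacobian of $T$ has modulus less than $1$ and the other has modulus greater than $1$; a nonhyperbolic equilibrium is one at which the Jacobian has an eigenvalue of modulus $1$; the basin of attraction of an equilibrium (for a saddle point: its global stable manifold) is the set of all initial conditions whose solution converges to it; and $\lim(x_n,y_n)=(0,\infty)$ means $x_n\to0$ and $y_n\to\infty$. 1. If $\gamma_2>\alpha_1/A_1$, then the unique equilibrium $(\alpha_1/A_1,0)$ is a saddle point with stable manifold $(0,\infty)\times\{0\}$, and whenever $(x_0,y_0)\notin(0,\infty)\times\{0\}$, then $\lim_{n\to\infty}(x_n,y_n)=(0,\infty)$. 2. If $\gamma_2=\alpha_1/A_1$, then the unique equilibrium $(\alpha_1/A_1,0)$ is nonhyperbolic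 with basin of attraction $(0,\infty)\times\{0\}$, and whenever $(x_0,y_0)\notin(0,\infty)\times\{0\}$, then $\lim_{n\to\infty}(x_n,y_n)=(0,\infty)$. 3. If $\gamma_2<\alpha_1/A_1$, then there are exactly two equilibria, $(\alpha_1/A_1,0)$ and $(\gamma_2,\alpha_1/\gamma_2-A_1)$. The equilibrium $(\alpha_1/A_1,0)$ is locally asymptotically stable, and the equilibrium $(\gamma_2,\alpha_1/\gamma_2-A_1)$ is a saddle point. Moreover, there is a strictly increasing $C^\infty$ function $C:(0,\infty)\to(0,\infty)$ whose graph $\{(x,y)\in(0,\infty)^2 : y=C(x)\}$ is the global stable manifold of the saddle point $(\gamma_2,\alpha_1/\gamma_2-A_1)$ and an invariant separatrix: it is mapped into itself by $T$, and it is the common boundary in $(0,\infty)^2$ of the two connected open regions $\{y>C(x)\}$ and $\{y<C(x)\}$ of $(0,\infty)^2$, each of which is mapped into itself by $T$. If $y_0>C(x_0)$, then $\lim_{n\to\infty}(x_n,y_n)=(0,\infty)$. If $y_0=C(x_0)$, then $\lim_{n\to\infty}(x_n,y_n)=(\gamma_2,\alpha_1/\gamma_2-A_1)$. If $y_0<C(x_0)$,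 then $\lim_{n\to\infty}(x_n,y_n)=(\alpha_1/A_1,0)$. -/

import Mathlib

open Set Filter Topology

noncomputable section

/-- The map `(x, y) ↦ (α₁ / (A₁ + y), γ₂ y / x)` of the system; it has its intended meaning where
`A₁ + y ≠ 0` and `x ≠ 0`. -/
def ratMap (α₁ A₁ γ₂ : ℝ) (p : ℝ × ℝ) : ℝ × ℝ :=
  (α₁ / (A₁ + p.2), γ₂ * p.2 / p.1)

/-- The `n`-th term `(xₙ, yₙ)` of the solution with initial condition `p = (x₀, y₀)`. -/
def orbit (α₁ A₁ γ₂ : ℝ) (p : ℝ × ℝ) (n : ℕ) : ℝ × ℝ :=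
  (ratMap α₁ A₁ γ₂)^[n] p

/-- The admissible initial conditions: nonnegative, and no denominator ever vanishes along the
orbit. -/
def admissible (α₁ A₁ γ₂ : ℝ) : Set (ℝ × ℝ) :=
  {p | 0 ≤ p.1 ∧ 0 ≤ p.2 ∧
    ∀ n, A₁ + (orbit α₁ A₁ γ₂ p n).2 ≠ 0 ∧ (orbit α₁ A₁ γ₂ p n).1 ≠ 0}

/-- The equilibria of the system. -/
def equilibria (α₁ A₁ γ₂ : ℝ) : Set (ℝ × ℝ) :=
  {p | p ∈ admissible α₁ A₁ γ₂ ∧ ratMap α₁ A₁ γ₂ p = p}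

/-- The set of all admissible initial conditions whose orbit converges to `z`. This is the basin
of attraction of an equilibrium `z`; for a saddle point it is also called its global stable
manifold. -/
def basin (α₁ A₁ γ₂ : ℝ) (z : ℝ × ℝ) : Set (ℝ × ℝ) :=
  {p | p ∈ admissible α₁ A₁ γ₂ ∧ Tendsto (orbit α₁ A₁ γ₂ p) atTop (𝓝 z)}

/-- `lim (xₙ, yₙ) = (0, ∞)` for the orbit of `p`. -/
def TendsToZeroInfty (α₁ A₁ γ₂ : ℝ) (p : ℝ × ℝ) : Prop :=
  Tendsto (fun n => (orbit α₁ A₁ γ₂ p n).1) atTop (𝓝 0) ∧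
    Tendsto (fun n => (orbit α₁ A₁ γ₂ p n).2) atTop atTop

/-- The complex eigenvalues, with multiplicity, of the Jacobian of `T` at `z`. -/
def jacobianEigenvalues (T : ℝ × ℝ → ℝ × ℝ) (z : ℝ × ℝ) : Multiset ℂ :=
  ((fderiv ℝ T z : ℝ × ℝ →L[ℝ] ℝ × ℝ) : ℝ × ℝ →ₗ[ℝ] ℝ × ℝ).charpoly.aroots ℂ

/-- `z` is a saddle point: a fixed point near which `T` is `C¹`, with one eigenvalue of the
Jacobian inside and the other one outside the unit circle. -/
def IsSaddlePoint (T : ℝ × ℝ → ℝ × ℝ) (z : ℝ × ℝ) : Prop :=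
  T z = z ∧ ContDiffAt ℝ 1 T z ∧
    ∃ l m : ℂ, jacobianEigenvalues T z = {l, m} ∧ ‖l‖ < 1 ∧ 1 < ‖m‖

/-- `z` is a nonhyperbolic fixed point: `T` is `C¹` near `z`, and some eigenvalue of the Jacobian
lies on the unit circle. -/
def IsNonhyperbolic (T : ℝ × ℝ → ℝ × ℝ) (z : ℝ × ℝ) : Prop :=
  T z = z ∧ ContDiffAt ℝ 1 T z ∧ ∃ l ∈ jacobianEigenvalues T z, ‖l‖ = 1

/-- `z` is a locally asymptotically stable equilibrium: Lyapunov stable and locally attracting,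
with respect to admissible initial conditions. -/
def IsLocallyAsymptoticallyStable (α₁ A₁ γ₂ : ℝ) (z : ℝ × ℝ) : Prop :=
  z ∈ equilibria α₁ A₁ γ₂ ∧
  (∀ ε > 0, ∃ δ > 0, ∀ p ∈ admissible α₁ A₁ γ₂, dist p z < δ →
    ∀ n, dist (orbit α₁ A₁ γ₂ p n) z < ε) ∧
  (∃ η > 0, ∀ p ∈ admissible α₁ A₁ γ₂, dist p z < η →
    Tendsto (orbit α₁ A₁ γ₂ p) atTop (𝓝 z))

/-- `S` is an invariant set of `T` that separates the region `R` into the two connected open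
invariant regions `U` and `V`, and is their common boundary in `R`. -/
structure IsInvariantSeparatrix (T : ℝ × ℝ → ℝ × ℝ) (R S U V : Set (ℝ × ℝ)) : Prop where
  subset : S ⊆ R
  invariant : MapsTo T S S
  invariant_left : MapsTo T U U
  invariant_right : MapsTo T V V
  isOpen_left : IsOpen U
  isOpen_right : IsOpen V
  isConnected_left : IsConnected U
  isConnected_right : IsConnected V
  disjoint : Disjoint U V
  diff_eq : R \ S = U ∪ V
  boundary_left : R ∩ frontier U = S
  boundary_right : R ∩ frontier V = S

end

/-!
For `n ≥ 0` one has `x (n + 1) = α₁ / (A₁ + y n)`, so the second components of an orbit satisfy the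
second-order equation `y (n + 2) = k (A₁ + y n) y (n + 1)` with `k = γ₂ / α₁`. Its right-hand side
is increasing in both arguments, and the ratio of two ordered solutions is nondecreasing
(`IsPosSol.exists_ratio`). If `k A₁ ≥ 1`, positive solutions are nondecreasing and tend to `∞`.

If `k A₁ < 1`, there is a positive equilibrium `e`. Comparison with `e` shows that a solution with
two consecutive terms on the same side of `e` tends to `0` or `∞`, and a solution that changes sides
at every step converges to `e` geometrically (`IsPosSol.trichotomy`). On every vertical half-line
the initial points leading to `0` and to `∞` form nonempty open sets, so by connectedness some point
leads to `e`; by the growth of ratios it is unique. This defines `C`, and the same comparison shows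
that `C` is strictly increasing and that the side of its graph decides the limit
(`exists_stable_graph`).

Smoothness of `C` comes from the inverse function theorem in the Banach algebra of bounded
sequences. The map sending `v` to the defect `v (n + 2) - k (A₁ + v n) v (n + 1)` together with
`γ₂ * v 0 / v 1` (the abscissa of the initial point) is smooth near a positive solution. At a
solution converging to `e` its derivative is bijective (`bijective_fderiv_defectMap`): in the
relative variations `δ n / v n` this is a statement about bounded solutions of
`ε (n + 2) = ε (n + 1) + q n * ε n + η n` with `q` between two constants in `(0, 1)`, which is
elementary (`eq_zero_of_bounded`, `exists_bounded_solution`). The local inverse gives a smooth family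
of solutions that are bounded and bounded away from `0`. By the trichotomy these converge to `e`, so
their initial points lie on the graph of `C`.
-/

/-! ### Positive solutions of the second-order equation -/

/-- A positive solution of the second-order equation `y (n + 2) = k (A + y n) y (n + 1)`. -/
structure IsPosSol (k A : ℝ) (y : ℕ → ℝ) : Prop where
  pos : ∀ n, 0 < y n
  step : ∀ n, y (n + 2) = k * (A + y n) * y (n + 1)

namespace IsPosSol

variable {k A : ℝ} {u v y : ℕ → ℝ}

lemma shift (hy : IsPosSol k A y) (m : ℕ) : IsPosSol k A fun n => y (n + m) where
  pos n := hy.pos _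
  step n := by
    have := hy.step (n + m)
    rwa [show n + 2 + m = n + m + 2 by ring, show n + 1 + m = n + m + 1 by ring]

lemma const {e : ℝ} (he : 0 < e) (hk : k * (A + e) = 1) : IsPosSol k A fun _ => e where
  pos _ := he
  step _ := by rw [hk, one_mul]

/-- Solutions are ordered as their first two terms are. -/
lemma mono (hk : 0 < k) (hA : 0 < A) (hu : IsPosSol k A u) (hv : IsPosSol k A v)
    (h0 : u 0 ≤ v 0) (h1 : u 1 ≤ v 1) (n : ℕ) : u n ≤ v n := by
  suffices H : u n ≤ v n ∧ u (n + 1) ≤ v (n + 1) from H.1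
  induction n with
  | zero => exact ⟨h0, h1⟩
  | succ n ih =>
    refine ⟨ih.2, ?_⟩
    rw [hu.step, hv.step]
    have := hu.pos n
    have := hu.pos (n + 1)
    have := hv.pos n
    gcongr
    exacts [ih.1, ih.2]

/-- The ratio of two ordered solutions is nondecreasing; hence, if the solutions differ, then it
stays above a constant larger than `1`. -/
lemma exists_ratio (hk : 0 < k) (hA : 0 < A) (hu : IsPosSol k A u) (hv : IsPosSol k A v)
    (h0 : u 0 ≤ v 0) (h1 : u 1 ≤ v 1) (h : u 0 < v 0 ∨ u 1 < v 1) :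
    ∃ r, 1 < r ∧ ∀ n, r * u (n + 2) ≤ v (n + 2) := by
  have hle := hu.mono hk hA hv h0 h1
  refine ⟨v 2 / u 2, ?_, fun n => ?_⟩
  · rw [one_lt_div (hu.pos 2), hu.step 0, hv.step 0]
    have := hu.pos 0
    have := hv.pos 0
    have := hu.pos 1
    have := hv.pos 1
    rcases h with h | h
    · calc k * (A + u 0) * u (0 + 1) < k * (A + v 0) * u (0 + 1) := by gcongr
        _ ≤ _ := by gcongr
    · calc k * (A + u 0) * u (0 + 1) < k * (A + u 0) * v (0 + 1) := by gcongr
        _ ≤ _ := by gcongr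
  · have hu2 := hu.pos 2
    have hv2 := hv.pos 2
    induction n with
    | zero => rw [div_mul_cancel₀ _ hu2.ne']
    | succ n ih =>
      have := hu.pos (n + 1)
      have := hv.pos (n + 1)
      have := hu.pos (n + 2)
      have h3 := hle (n + 1)
      rw [show n + 1 + 2 = n + 3 by ring, hu.step (n + 1), hv.step (n + 1)]
      calc v 2 / u 2 * (k * (A + u (n + 1)) * u (n + 1 + 1))
          = k * (A + u (n + 1)) * (v 2 / u 2 * u (n + 2)) := by ring
        _ ≤ k * (A + v (n + 1)) * v (n + 2) := by gcongr

/-- A finite limit of a solution is a fixed point of the recurrence. -/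
lemma limit_eq (hy : IsPosSol k A y) {l : ℝ} (h : Tendsto y atTop (𝓝 l)) :
    l = k * (A + l) * l := by
  have h2 := (tendsto_add_atTop_iff_nat 2).2 h
  have h1 := (tendsto_add_atTop_iff_nat 1).2 h
  refine tendsto_nhds_unique h2 ?_
  simp_rw [hy.step]
  exact (tendsto_const_nhds.mul (tendsto_const_nhds.add h)).mul h1

/-- A solution is unbounded as soon as the growth factor `k (A + y n)` stays above a constant larger
than `1`. -/
lemma tendsto_atTop_of_le (hk : 0 < k) (hy : IsPosSol k A y) {r : ℝ} (hr : 1 < k * (A + r))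
    (h : ∀ n, r ≤ y (n + 1)) : Tendsto y atTop atTop := by
  have hm : Monotone fun n => y (n + 2) := by
    refine monotone_nat_of_le_succ fun n => ?_
    have e : y (n + 1 + 2) = k * (A + y (n + 1)) * y (n + 2) := hy.step (n + 1)
    rw [e]
    have h1 : k * (A + r) ≤ k * (A + y (n + 1)) := by gcongr; exact h n
    exact le_mul_of_one_le_left (hy.pos _).le (hr.le.trans h1)
  rcases tendsto_atTop_of_monotone hm with H | ⟨l, H⟩
  · exact (tendsto_add_atTop_iff_nat 2).1 H
  · have H' := (tendsto_add_atTop_iff_nat 2).1 H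
    have hl : r ≤ l := ge_of_tendsto' ((tendsto_add_atTop_iff_nat 1).2 H') h
    have hl0 : 0 < l := (hy.pos 2).trans_le (hm.ge_of_tendsto H 0)
    have h1 : k * (A + r) ≤ k * (A + l) := by gcongr
    have := hy.limit_eq H'
    nlinarith

section Equilibrium

variable {e : ℝ}

lemma tendsto_atTop (hk : 0 < k) (hA : 0 < A) (he : 0 < e)
    (hke : k * (A + e) = 1) (hy : IsPosSol k A y) (h0 : e ≤ y 0) (h1 : e ≤ y 1)
    (h : e < y 0 ∨ e < y 1) : Tendsto y atTop atTop := by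
  obtain ⟨r, hr, H⟩ := (IsPosSol.const he hke).exists_ratio hk hA hy h0 h1 h
  rw [← tendsto_add_atTop_iff_nat 2]
  refine (hy.shift 2).tendsto_atTop_of_le hk (r := r * e) ?_ fun n => H (n + 1)
  rw [← hke]
  have : e < r * e := lt_mul_of_one_lt_left he hr
  gcongr

lemma tendsto_zero (hk : 0 < k) (hA : 0 < A) (he : 0 < e)
    (hke : k * (A + e) = 1) (hy : IsPosSol k A y) (h0 : y 0 ≤ e) (h1 : y 1 ≤ e)
    (h : y 0 < e ∨ y 1 < e) : Tendsto y atTop (𝓝 0) := by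
  have hle := hy.mono hk hA (.const he hke) h0 h1
  obtain ⟨r, hr, H⟩ := hy.exists_ratio hk hA (.const he hke) h0 h1 h
  have hm : Antitone fun n => y (n + 1) := by
    refine antitone_nat_of_succ_le fun n => ?_
    have e1 : y (n + 1 + 1) = k * (A + y n) * y (n + 1) := hy.step n
    rw [e1]
    refine mul_le_of_le_one_left (hy.pos _).le ?_
    rw [← hke]
    gcongr
    exact hle n
  have hb : BddBelow (range fun n => y (n + 1)) :=
    ⟨0, by rintro _ ⟨n, rfl⟩; exact (hy.pos _).le⟩
  have hl := (tendsto_add_atTop_iff_nat 1).1 (tendsto_atTop_ciInf hm hb)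
  set l := ⨅ n, y (n + 1)
  have hl0 : 0 ≤ l := ge_of_tendsto' hl fun n => (hy.pos n).le
  have hre : r * l ≤ e := le_of_tendsto' (((tendsto_add_atTop_iff_nat 2).2 hl).const_mul r) H
  have hlim := hy.limit_eq hl
  rcases hl0.eq_or_lt with h | h
  · rwa [← h] at hl
  · have : k * (A + l) < k * (A + e) := by gcongr; nlinarith
    nlinarith

/-- A solution that changes sides of the equilibrium `e` at every step converges to `e`: the
relative deviation `max (y n / e) (e / y n) - 1` shrinks by the factor `e / (A + e)` each time. -/
lemma tendsto_of_alternating (hA : 0 < A) (he : 0 < e)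
    (hke : k * (A + e) = 1) (hy : IsPosSol k A y)
    (h : ∀ n, (y n - e) * (y (n + 1) - e) < 0) : Tendsto y atTop (𝓝 e) := by
  set R : ℕ → ℝ := fun n => max (y n / e) (e / y n) - 1 with hR
  have hk' : k = 1 / (A + e) := by field_simp; linarith
  set θ := e / (A + e) with hθ
  have hθ0 : 0 ≤ θ := by positivity
  have hθ1 : θ < 1 := by rw [hθ, div_lt_one (by positivity)]; linarith
  have habove {n} (hn : e < y n) : R n = y n / e - 1 := by
    rw [hR]
    have h1 : 1 ≤ y n / e := by rw [one_le_div he]; exact hn.le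
    have h2 : e / y n ≤ 1 := by rw [div_le_one (hy.pos n)]; exact hn.le
    simp [max_eq_left (h2.trans h1)]
  have hbelow {n} (hn : y n < e) : R n = e / y n - 1 := by
    rw [hR]
    have h1 : 1 ≤ e / y n := by rw [one_le_div (hy.pos n)]; exact hn.le
    have h2 : y n / e ≤ 1 := by rw [div_le_one he]; exact hn.le
    simp [max_eq_right (h2.trans h1)]
  have hstep (n) : R (n + 1) ≤ θ * R n := by
    have h0 := hy.pos n
    have h1 := hy.pos (n + 1)
    have hr := hy.step n
    have hn := h n
    have hn' := h (n + 1)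
    rw [show n + 1 + 1 = n + 2 by ring, hr, hk'] at hn'
    rcases lt_trichotomy (y n) e with hlt | heq | hgt
    · have hgt1 : e < y (n + 1) := by nlinarith
      have h3 : 1 / (A + e) * (A + y n) * y (n + 1) < e := by nlinarith
      rw [hbelow hlt, habove hgt1, hθ]
      have h4 : (A + y n) * y (n + 1) < e * (A + e) := by
        rw [← sub_neg] at h3 ⊢
        have : (A + y n) * y (n + 1) - e * (A + e)
          = (1 / (A + e) * (A + y n) * y (n + 1) - e) * (A + e) := by field_simp
        rw [this]
        exact mul_neg_of_neg_of_pos h3 (by positivity)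
      have h5 : y (n + 1) / e - 1 ≤ (A + e) / (A + y n) - 1 := by
        gcongr ?_ - 1
        rw [div_le_div_iff₀ he (by positivity)]
        nlinarith
      refine h5.trans ?_
      have e1 : (A + e) / (A + y n) - 1 = (e - y n) / (A + y n) := by field_simp; ring
      have e2 : e / (A + e) * (e / y n - 1) = (e * (e - y n)) / ((A + e) * y n) := by field_simp
      rw [e1, e2, div_le_div_iff₀ (by positivity) (by positivity)]
      have : (A + e) * y n ≤ e * (A + y n) := by nlinarith
      nlinarith
    · simp [heq] at hn
    · have hlt1 : y (n + 1) < e := by nlinarith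
      have h3 : e < 1 / (A + e) * (A + y n) * y (n + 1) := by nlinarith
      rw [habove hgt, hbelow hlt1, hθ]
      have h4 : e * (A + e) < (A + y n) * y (n + 1) := by
        rw [← sub_pos] at h3 ⊢
        have : (A + y n) * y (n + 1) - e * (A + e)
          = (1 / (A + e) * (A + y n) * y (n + 1) - e) * (A + e) := by field_simp
        rw [this]
        exact mul_pos h3 (by positivity)
      have e1 : e / (A + e) * (y n / e - 1) = (A + y n) / (A + e) - 1 := by field_simp; ring
      rw [e1]
      gcongr ?_ - 1
      rw [div_le_div_iff₀ h1 (by positivity)]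
      exact h4.le
  have hgeom (n) : R n ≤ θ ^ n * R 0 := by
    induction n with
    | zero => simp
    | succ n ih => calc R (n + 1) ≤ θ * R n := hstep n
        _ ≤ θ * (θ ^ n * R 0) := by gcongr
        _ = _ := by ring
  have hdist (n) : |y n - e| ≤ e * R n := by
    have h0 := hy.pos n
    rcases lt_trichotomy (y n) e with hlt | heq | hgt
    · rw [abs_of_neg (by linarith), hbelow hlt]
      have : e * (e / y n - 1) = e / y n * (e - y n) := by field_simp
      rw [this]
      have : 1 ≤ e / y n := by rw [one_le_div h0]; exact hlt.le
      nlinarith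
    · have := h n
      simp [heq] at this
    · rw [abs_of_pos (by linarith), habove hgt]
      apply le_of_eq
      field_simp
  rw [tendsto_iff_dist_tendsto_zero]
  have hlim : Tendsto (fun n => e * (θ ^ n * R 0)) atTop (𝓝 0) := by
    simpa using ((tendsto_pow_atTop_nhds_zero_of_lt_one hθ0 hθ1).mul_const (R 0)).const_mul e
  refine squeeze_zero (fun n => dist_nonneg) (fun n => ?_) hlim
  rw [Real.dist_eq]
  exact (hdist n).trans (by gcongr; exact hgeom n)

/-- Every positive solution tends to `0`, to `∞`, or to the equilibrium. -/
lemma trichotomy (hk : 0 < k) (hA : 0 < A) (he : 0 < e)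
    (hke : k * (A + e) = 1) (hy : IsPosSol k A y) :
    Tendsto y atTop (𝓝 0) ∨ Tendsto y atTop atTop ∨ Tendsto y atTop (𝓝 e) := by
  by_cases h : ∀ n, (y n - e) * (y (n + 1) - e) < 0
  · exact .inr (.inr (hy.tendsto_of_alternating hA he hke h))
  push Not at h
  obtain ⟨n, hn⟩ := h
  have hs := hy.shift n
  have e1 : y (n + 1) = y (1 + n) := by rw [add_comm]
  rw [e1] at hn
  rcases eq_or_ne (y n) e with h0 | h0
  · rcases lt_trichotomy (y (1 + n)) e with h1 | h1 | h1
    · left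
      rw [← tendsto_add_atTop_iff_nat n]
      exact hs.tendsto_zero hk hA he hke (by simp [h0]) h1.le (.inr h1)
    · right; right
      rw [← tendsto_add_atTop_iff_nat n]
      have hle := hs.mono hk hA (.const he hke) (by simp [h0]) h1.le
      have hge := (IsPosSol.const he hke).mono hk hA hs (by simp [h0]) h1.ge
      have : (fun m => y (m + n)) = fun _ => e := funext fun m => le_antisymm (hle m) (hge m)
      rw [this]
      exact tendsto_const_nhds
    · right; left
      rw [← tendsto_add_atTop_iff_nat n]
      exact hs.tendsto_atTop hk hA he hke (by simp [h0]) h1.le (.inr h1)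
  · rcases h0.lt_or_gt with h0 | h0
    · left
      rw [← tendsto_add_atTop_iff_nat n]
      exact hs.tendsto_zero hk hA he hke (by simp [h0.le]) (by nlinarith) (.inl (by simpa))
    · right; left
      rw [← tendsto_add_atTop_iff_nat n]
      exact hs.tendsto_atTop hk hA he hke (by simp [h0.le]) (by nlinarith) (.inl (by simpa))

/-- A solution above one that converges to the equilibrium tends to `∞`. -/
lemma tendsto_atTop_of_lt (hk : 0 < k) (hA : 0 < A) (he : 0 < e) (hke : k * (A + e) = 1)
    (hu : IsPosSol k A u) (hv : IsPosSol k A v) (h0 : u 0 ≤ v 0) (h1 : u 1 ≤ v 1)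
    (h : u 0 < v 0 ∨ u 1 < v 1) (hlim : Tendsto u atTop (𝓝 e)) : Tendsto v atTop atTop := by
  obtain ⟨r, hr, H⟩ := hu.exists_ratio hk hA hv h0 h1 h
  have hlt : e < r * e := lt_mul_of_one_lt_left he hr
  have hlow {l : ℝ} (hl : Tendsto v atTop (𝓝 l)) : r * e ≤ l :=
    le_of_tendsto_of_tendsto' (((tendsto_add_atTop_iff_nat 2).2 hlim).const_mul r)
      ((tendsto_add_atTop_iff_nat 2).2 hl) H
  rcases hv.trichotomy hk hA he hke with hl | hl | hl
  · linarith [hlow hl]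
  · exact hl
  · linarith [hlow hl]

/-- A solution below one that converges to the equilibrium tends to `0`. -/
lemma tendsto_zero_of_lt (hk : 0 < k) (hA : 0 < A) (he : 0 < e) (hke : k * (A + e) = 1)
    (hu : IsPosSol k A u) (hv : IsPosSol k A v) (h0 : u 0 ≤ v 0) (h1 : u 1 ≤ v 1)
    (h : u 0 < v 0 ∨ u 1 < v 1) (hlim : Tendsto v atTop (𝓝 e)) : Tendsto u atTop (𝓝 0) := by
  rcases hu.trichotomy hk hA he hke with hl | hl | hl
  · exact hl
  · have := tendsto_atTop_mono (hu.mono hk hA hv h0 h1) hl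
    exact absurd hlim (not_tendsto_nhds_of_tendsto_atTop this _)
  · have := hu.tendsto_atTop_of_lt hk hA he hke hv h0 h1 h hl
    exact absurd hlim (not_tendsto_nhds_of_tendsto_atTop this _)

end Equilibrium

end IsPosSol

/-! ### Bounded solutions of the linearized equation -/

/-- The solution of the linear equation `ε (n + 2) = ε (n + 1) + q n * ε n + η n` with first two
terms `a` and `b`. -/
def linSol (q η : ℕ → ℝ) (a b : ℝ) : ℕ → ℝ
  | 0 => a
  | 1 => b
  | n + 2 => linSol q η a b (n + 1) + q n * linSol q η a b n + η n

section LinearEquation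

variable {q : ℕ → ℝ} {q₀ κ : ℝ}

/-- The homogeneous solution starting from `1, 1` grows geometrically. -/
lemma linSol_one_growth (hq₀ : 0 < q₀) (hκ : κ < 1) (hq : ∀ n, q₀ ≤ q n) (hq' : ∀ n, q n ≤ κ)
    (n : ℕ) : 1 ≤ linSol q 0 1 1 n ∧
      linSol q 0 1 1 n ≤ linSol q 0 1 1 (n + 1) ∧
      linSol q 0 1 1 (n + 1) ≤ 2 * linSol q 0 1 1 n ∧
      (1 + q₀ / 2) * linSol q 0 1 1 (n + 1) ≤ linSol q 0 1 1 (n + 2) := by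
  have hrec (n) : linSol q 0 1 1 (n + 2) = linSol q 0 1 1 (n + 1) + q n * linSol q 0 1 1 n := by
    simp [linSol]
  suffices H : 1 ≤ linSol q 0 1 1 n ∧ linSol q 0 1 1 n ≤ linSol q 0 1 1 (n + 1) ∧
      linSol q 0 1 1 (n + 1) ≤ 2 * linSol q 0 1 1 n by
    refine ⟨H.1, H.2.1, H.2.2, ?_⟩
    rw [hrec]
    nlinarith [hq n]
  induction n with
  | zero => simp [linSol]
  | succ n ih =>
    rw [show n + 1 + 1 = n + 2 by ring, hrec]
    obtain ⟨h1, h2, h3⟩ := ih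
    have := hq n
    have := hq' n
    refine ⟨by linarith, ?_, ?_⟩ <;> nlinarith

lemma linSol_one_ge (hq₀ : 0 < q₀) (hκ : κ < 1) (hq : ∀ n, q₀ ≤ q n) (hq' : ∀ n, q n ≤ κ)
    (n m : ℕ) :
    (1 + q₀ / 2) ^ m * linSol q 0 1 1 (n + 1) ≤ linSol q 0 1 1 (n + m + 1) := by
  induction m with
  | zero => simp
  | succ m ih =>
    have := (linSol_one_growth hq₀ hκ hq hq' (n + m)).2.2.2
    calc (1 + q₀ / 2) ^ (m + 1) * linSol q 0 1 1 (n + 1)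
        = (1 + q₀ / 2) * ((1 + q₀ / 2) ^ m * linSol q 0 1 1 (n + 1)) := by ring
      _ ≤ (1 + q₀ / 2) * linSol q 0 1 1 (n + m + 1) := by gcongr
      _ ≤ _ := this

/-- The only bounded homogeneous solution with `ε 0 = ε 1` is `0`. -/
lemma eq_zero_of_bounded (hq₀ : 0 < q₀) (hκ : κ < 1) (hq : ∀ n, q₀ ≤ q n) (hq' : ∀ n, q n ≤ κ)
    {ε : ℕ → ℝ} (h0 : ε 0 = ε 1) (hrec : ∀ n, ε (n + 2) = ε (n + 1) + q n * ε n)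
    {K : ℝ} (hK : ∀ n, |ε n| ≤ K) (n : ℕ) : ε n = 0 := by
  have hε (n) : ε n = ε 0 * linSol q 0 1 1 n ∧ ε (n + 1) = ε 0 * linSol q 0 1 1 (n + 1) := by
    induction n with
    | zero => simp [linSol, h0]
    | succ n ih =>
      refine ⟨ih.2, ?_⟩
      rw [show n + 1 + 1 = n + 2 by ring, hrec, ih.1, ih.2]
      simp [linSol]
      ring
  suffices H : ε 0 = 0 by rw [(hε n).1, H, zero_mul]
  by_contra hne
  have hpos : 0 < |ε 0| := abs_pos.2 hne
  obtain ⟨m, hm⟩ := pow_unbounded_of_one_lt (K / |ε 0|) (show 1 < 1 + q₀ / 2 by linarith)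
  have h1 := linSol_one_ge hq₀ hκ hq hq' 0 m
  have h2 := hK (0 + m + 1)
  rw [(hε _).1, abs_mul] at h2
  have h3 : (1 + q₀ / 2) ^ m ≤ |linSol q 0 1 1 (0 + m + 1)| := by
    refine le_trans ?_ (le_abs_self _)
    simpa [linSol] using h1
  rw [div_lt_iff₀ hpos] at hm
  nlinarith

/-- Every bounded right-hand side `η` admits a bounded solution with prescribed `ε 0 - ε 1`. A
particular solution `y` is corrected by a multiple of the growing solution `z`. The ratios
`y n / z n` converge, at the rate `1 / z n`, because the Casoratian `w n` satisfies
`w (n + 1) = - q n * w n + η n * z (n + 1)` and is therefore `O (z n)`. -/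
lemma exists_bounded_solution (hq₀ : 0 < q₀) (hκ : κ < 1) (hq : ∀ n, q₀ ≤ q n)
    (hq' : ∀ n, q n ≤ κ) {η : ℕ → ℝ} {M : ℝ} (hη : ∀ n, |η n| ≤ M) (s : ℝ) :
    ∃ ε : ℕ → ℝ, ε 0 - ε 1 = s ∧ (∀ n, ε (n + 2) = ε (n + 1) + q n * ε n + η n) ∧
      ∃ K, ∀ n, |ε n| ≤ K := by
  have hM : 0 ≤ M := (abs_nonneg _).trans (hη 0)
  set z := linSol q 0 1 1 with hz
  set y := linSol q η 0 (-s) with hy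
  have hzrec (n) : z (n + 2) = z (n + 1) + q n * z n := by simp [hz, linSol]
  have hyrec (n) : y (n + 2) = y (n + 1) + q n * y n + η n := by simp [hy, linSol]
  have hgr := linSol_one_growth hq₀ hκ hq hq'
  have hz0 (n) : 0 < z n := zero_lt_one.trans_le (hgr n).1
  set μ := 1 + q₀ / 2 with hμ
  have hμ1 : 1 < μ := by linarith
  -- the bound of the Casoratian
  set K := |s| + M / (1 - κ) with hK
  have hMκ : M ≤ (1 - κ) * K := by
    have : (1 - κ) * (M / (1 - κ)) = M := by field_simp [show 1 - κ ≠ 0 by linarith]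
    have : 0 ≤ (1 - κ) * |s| := mul_nonneg (by linarith) (abs_nonneg s)
    rw [hK, mul_add]
    linarith
  have hK0 : 0 ≤ K := add_nonneg (abs_nonneg s) (div_nonneg hM (by linarith))
  have hw (n) : |y (n + 1) * z n - y n * z (n + 1)| ≤ K * z n := by
    induction n with
    | zero =>
      have : |s| ≤ K := le_add_of_nonneg_right (div_nonneg hM (by linarith))
      simpa [hz, hy, linSol] using this
    | succ n ih =>
      have e : y (n + 1 + 1) * z (n + 1) - y (n + 1) * z (n + 1 + 1)
          = -q n * (y (n + 1) * z n - y n * z (n + 1)) + η n * z (n + 1) := by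
        rw [show n + 1 + 1 = n + 2 by ring, hzrec, hyrec]
        ring
      rw [e]
      have hqn : |-q n| ≤ κ := by
        rw [abs_neg, abs_of_nonneg (hq₀.le.trans (hq n))]
        exact hq' n
      have hκ0 : 0 ≤ κ := (abs_nonneg _).trans hqn
      calc _ ≤ |-q n| * |y (n + 1) * z n - y n * z (n + 1)| + |η n| * |z (n + 1)| := by
            rw [← abs_mul, ← abs_mul]; exact abs_add_le _ _
        _ ≤ κ * (K * z n) + M * z (n + 1) := by
            rw [abs_of_pos (hz0 (n + 1))]
            have := hη n
            have := (hz0 (n + 1)).le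
            gcongr
        _ ≤ κ * (K * z (n + 1)) + M * z (n + 1) := by
            have : z n ≤ z (n + 1) := (hgr n).2.1
            gcongr
        _ ≤ K * z (n + 1) := by nlinarith [hz0 (n + 1)]
  set f : ℕ → ℝ := fun n => y n / z n with hf
  have hstep (n) : dist (f n) (f (n + 1)) ≤ K / z (n + 1) := by
    have h0 := hz0 n
    have h1 := hz0 (n + 1)
    rw [Real.dist_eq, hf, abs_sub_comm]
    have : y (n + 1) / z (n + 1) - y n / z n
        = (y (n + 1) * z n - y n * z (n + 1)) / (z n * z (n + 1)) := by field_simp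
    simp only []
    rw [this, abs_div, abs_of_pos (mul_pos h0 h1), div_le_div_iff₀ (by positivity) h1]
    have := mul_le_mul_of_nonneg_right (hw n) h1.le
    linarith
  have hstep' (n m) : dist (f (n + m)) (f (n + (m + 1))) ≤ K / z (n + 1) * μ⁻¹ ^ m := by
    have h1 := linSol_one_ge hq₀ hκ hq hq' n m
    have h2 := hz0 (n + 1)
    refine (hstep (n + m)).trans ?_
    rw [inv_pow, ← div_eq_mul_inv, div_div]
    have : 0 < μ ^ m := by positivity
    gcongr
    rw [mul_comm]
    exact h1
  have hμi : μ⁻¹ < 1 := inv_lt_one_of_one_lt₀ hμ1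
  obtain ⟨l, hl⟩ : ∃ l, Tendsto f atTop (𝓝 l) := by
    refine cauchySeq_tendsto_of_complete
      (cauchySeq_of_le_geometric μ⁻¹ (K / z 1) hμi fun m => ?_)
    simpa using hstep' 0 m
  refine ⟨fun n => y n - l * z n, ?_, fun n => ?_, K / (1 - μ⁻¹), fun n => ?_⟩
  · simp only [hz, hy, linSol]
    ring
  · simp only [hzrec, hyrec]
    ring
  · have hl' : Tendsto (fun m => f (n + m)) atTop (𝓝 l) := by
      simpa [add_comm] using (tendsto_add_atTop_iff_nat n).2 hl
    have h1 := dist_le_of_le_geometric_of_tendsto₀ μ⁻¹ (K / z (n + 1)) hμi (hstep' n) hl'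
    have h0 := hz0 n
    have e : y n - l * z n = (f n - l) * z n := by simp only [hf]; field_simp
    beta_reduce
    rw [e, abs_mul, abs_of_pos h0, ← Real.dist_eq]
    have h2 : z n ≤ z (n + 1) := (hgr n).2.1
    have h3 : 0 < 1 - μ⁻¹ := by linarith
    calc dist (f n) l * z n ≤ K / z (n + 1) / (1 - μ⁻¹) * z (n + 1) := by
          have := hz0 (n + 1)
          gcongr
          simpa using h1
      _ = K / (1 - μ⁻¹) := by
          have := (hz0 (n + 1)).ne'
          field_simp

end LinearEquation

/-! ### Smooth families of bounded solutions -/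

open scoped BoundedContinuousFunction

/-- The shift `v ↦ v (· + m)` on bounded sequences. -/
noncomputable def shiftCLM (m : ℕ) : (ℕ →ᵇ ℝ) →L[ℝ] (ℕ →ᵇ ℝ) :=
  BoundedContinuousFunction.compContinuousCLM ℝ ℝ ⟨fun n => n + m, continuous_of_discreteTopology⟩

@[simp]
lemma shiftCLM_apply (m : ℕ) (v : ℕ →ᵇ ℝ) (n : ℕ) : shiftCLM m v n = v (n + m) := rfl

/-- The defect of a bounded sequence `v` as a solution of `v (n + 2) = k (A + v n) v (n + 1)`,
together with `g * v 0 / v 1`. Sequences with zero defect are the bounded solutions. -/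
noncomputable def defectMap (k A g : ℝ) (v : ℕ →ᵇ ℝ) : (ℕ →ᵇ ℝ) × ℝ :=
  (shiftCLM 2 v - k • ((A • 1 + v) * shiftCLM 1 v), g * v 0 / v 1)

lemma contDiffAt_defectMap (k A g : ℝ) {v : ℕ →ᵇ ℝ} (hv : v 1 ≠ 0) :
    ContDiffAt ℝ ((⊤ : ℕ∞) : WithTop ℕ∞) (defectMap k A g) v := by
  have h (i : ℕ) : ContDiff ℝ ((⊤ : ℕ∞) : WithTop ℕ∞) fun v : ℕ →ᵇ ℝ => v i :=
    (BoundedContinuousFunction.evalCLM ℝ i : (ℕ →ᵇ ℝ) →L[ℝ] ℝ).contDiff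
  have hs (m : ℕ) := (shiftCLM m).contDiff (n := ((⊤ : ℕ∞) : WithTop ℕ∞))
  refine ContDiffAt.prodMk ?_ ?_
  · exact ((hs 2).sub (((contDiff_const.add contDiff_id).mul (hs 1)).const_smul k)).contDiffAt
  · exact (contDiff_const.mul (h 0)).contDiffAt.div (h 1).contDiffAt hv

lemma fderiv_defectMap_apply (k A g : ℝ) {v : ℕ →ᵇ ℝ} (hv : v 1 ≠ 0) (δ : ℕ →ᵇ ℝ) :
    (∀ n, (fderiv ℝ (defectMap k A g) v δ).1 n =
      δ (n + 2) - k * ((A + v n) * δ (n + 1) + δ n * v (n + 1))) ∧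
    (fderiv ℝ (defectMap k A g) v δ).2 = g * (δ 0 * v 1 - v 0 * δ 1) / v 1 ^ 2 := by
  have h (i : ℕ) : HasFDerivAt (fun v : ℕ →ᵇ ℝ => v i)
      (BoundedContinuousFunction.evalCLM ℝ i) v :=
    (BoundedContinuousFunction.evalCLM ℝ i : (ℕ →ᵇ ℝ) →L[ℝ] ℝ).hasFDerivAt
  have hs (m : ℕ) : HasFDerivAt (fun v => shiftCLM m v) (shiftCLM m) v :=
    (shiftCLM m).hasFDerivAt
  have h1 := (hs 2).sub ((((hasFDerivAt_id v).const_add (A • 1)).mul (hs 1)).const_smul k)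
  have h2 := ((h 0).const_mul g).mul ((hasDerivAt_inv hv).comp_hasFDerivAt v (h 1))
  have h3 : HasFDerivAt (defectMap k A g) _ v := (h1.prodMk h2).congr_of_eventuallyEq
    (.of_forall fun w => Prod.ext rfl (div_eq_mul_inv _ _))
  rw [h3.fderiv]
  constructor
  · intro n
    simp
    ring
  · simp
    field_simp
    ring

/-- At a positive solution that is bounded and bounded away from `0`, the derivative of
`defectMap` is bijective. In the relative variations `ε n = δ n / v n` it becomes the linear
equation `ε (n + 2) = ε (n + 1) + q n * ε n + η n` with `q n = v n / (A + v n)`. -/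
lemma bijective_fderiv_defectMap {k A g c : ℝ} (hA : 0 < A) (hg : 0 < g)
    {v : ℕ →ᵇ ℝ} (hv : IsPosSol k A v) (hc : 0 < c) (hcv : ∀ n, c ≤ v n) :
    Function.Bijective (fderiv ℝ (defectMap k A g) v) := by
  have hpos := hv.pos
  set m := ‖v‖ with hm
  have hvm (n) : v n ≤ m := (le_abs_self _).trans (v.norm_coe_le_norm n)
  have hm0 : 0 < m := (hpos 0).trans_le (hvm 0)
  set q : ℕ → ℝ := fun n => v n / (A + v n) with hqdef
  have hq₀ : 0 < c / (A + m) := by positivity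
  have hκ : m / (A + m) < 1 := by rw [div_lt_one (by positivity)]; linarith
  have hq (n) : c / (A + m) ≤ q n := by
    have := hpos n
    simp only [hqdef]
    gcongr
    exacts [hcv n, hvm n]
  have hq' (n) : q n ≤ m / (A + m) := by
    have := hpos n
    have := hvm n
    simp only [hqdef]
    rw [div_le_div_iff₀ (by positivity) (by positivity)]
    nlinarith
  have hkey (δ : ℕ →ᵇ ℝ) (n : ℕ) : (fderiv ℝ (defectMap k A g) v δ).1 n =
      v (n + 2) * (δ (n + 2) / v (n + 2) - (δ (n + 1) / v (n + 1) + q n * (δ n / v n))) := by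
    have h0 := (hpos n).ne'
    have h1 := (hpos (n + 1)).ne'
    have h2 := (hpos (n + 2)).ne'
    have h3 : A + v n ≠ 0 := by have := hpos n; positivity
    rw [(fderiv_defectMap_apply k A g (hpos 1).ne' δ).1 n, mul_sub, mul_div_cancel₀ _ h2,
      hv.step n]
    simp only [hqdef]
    field_simp
  have hkey2 (δ : ℕ →ᵇ ℝ) : (fderiv ℝ (defectMap k A g) v δ).2 =
      g * v 0 / v 1 * (δ 0 / v 0 - δ 1 / v 1) := by
    have h0 := (hpos 0).ne'
    have h1 := (hpos 1).ne'
    rw [(fderiv_defectMap_apply k A g h1 δ).2]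
    field_simp
  constructor
  · rw [injective_iff_map_eq_zero]
    intro δ hδ
    have e1 (n) : δ (n + 2) / v (n + 2) = δ (n + 1) / v (n + 1) + q n * (δ n / v n) := by
      have := hkey δ n
      rw [hδ] at this
      have h2 := (hpos (n + 2)).ne'
      simp only [Prod.fst_zero, BoundedContinuousFunction.coe_zero, Pi.zero_apply, zero_eq_mul,
        h2, false_or] at this
      linarith
    have e2 : δ 0 / v 0 = δ 1 / v 1 := by
      have := hkey2 δ
      rw [hδ] at this
      have h0 := hpos 0
      have h1 := hpos 1
      have h2 : g * v 0 / v 1 ≠ 0 := by positivity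
      simp only [Prod.snd_zero, zero_eq_mul, h2, false_or] at this
      linarith
    have hb (n) : |δ n / v n| ≤ ‖δ‖ / c := by
      rw [abs_div, abs_of_pos (hpos n)]
      have := δ.norm_coe_le_norm n
      rw [Real.norm_eq_abs] at this
      gcongr
      exact hcv n
    ext n
    have := eq_zero_of_bounded hq₀ hκ hq hq' e2 e1 hb n
    simpa [(hpos n).ne'] using this
  · rintro ⟨η, s⟩
    have hη (n) : |η n / v (n + 2)| ≤ ‖η‖ / c := by
      rw [abs_div, abs_of_pos (hpos _)]
      have := η.norm_coe_le_norm n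
      rw [Real.norm_eq_abs] at this
      gcongr
      exact hcv _
    obtain ⟨ε, hε0, hε, K, hK⟩ :=
      exists_bounded_solution hq₀ hκ hq hq' hη (s / (g * v 0 / v 1))
    have hK0 : 0 ≤ K := (abs_nonneg _).trans (hK 0)
    let δ : ℕ →ᵇ ℝ := BoundedContinuousFunction.ofNormedAddCommGroupDiscrete
      (fun n => ε n * v n) (K * m) fun n => by
        rw [Real.norm_eq_abs, abs_mul, abs_of_pos (hpos n)]
        have := (hpos n).le
        gcongr
        exacts [hK n, hvm n]
    have hδ (n) : δ n / v n = ε n := mul_div_cancel_right₀ _ (hpos n).ne'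
    refine ⟨δ, Prod.ext ?_ ?_⟩
    · ext n
      rw [hkey, hδ, hδ, hδ, hε]
      have := (hpos (n + 2)).ne'
      field_simp
      ring
    · rw [hkey2, hδ, hδ, hε0]
      have h0 := (hpos 0).ne'
      have h1 := (hpos 1).ne'
      field_simp

/-- A solution that converges to a positive limit extends, by the inverse function theorem, to a
smooth one-parameter family of solutions `Y x`, bounded and bounded away from `0`, with
`g * Y x 0 / Y x 1 = x`. -/
lemma IsPosSol.exists_smooth_family {k A g e : ℝ} (hA : 0 < A) (hg : 0 < g)
    (he : 0 < e) {y : ℕ → ℝ} (hy : IsPosSol k A y) (hlim : Tendsto y atTop (𝓝 e)) :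
    ∃ Y : ℝ → ℕ → ℝ,
      ContDiffAt ℝ ((⊤ : ℕ∞) : WithTop ℕ∞) (fun x => Y x 0) (g * y 0 / y 1) ∧
      ∀ᶠ x in 𝓝 (g * y 0 / y 1), IsPosSol k A (Y x) ∧ g * Y x 0 / Y x 1 = x ∧
        ∃ c M, 0 < c ∧ ∀ n, c ≤ Y x n ∧ Y x n ≤ M := by
  obtain ⟨M, hM⟩ := hlim.bddAbove_range
  obtain ⟨c, hc, hcy⟩ : ∃ c, 0 < c ∧ ∀ n, c ≤ y n := by
    -- the reciprocals converge, hence are bounded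
    obtain ⟨B, hB⟩ := (hlim.inv₀ he.ne').bddAbove_range
    have hB' (n) : (y n)⁻¹ ≤ B := hB ⟨n, rfl⟩
    have hB0 : 0 < B := (inv_pos.2 (hy.pos 0)).trans_le (hB' 0)
    exact ⟨B⁻¹, inv_pos.2 hB0, fun n => inv_le_of_inv_le₀ (hy.pos n) (hB' n)⟩
  let v : ℕ →ᵇ ℝ := BoundedContinuousFunction.ofNormedAddCommGroupDiscrete y M fun n => by
    rw [Real.norm_eq_abs, abs_of_pos (hy.pos n)]
    exact hM ⟨n, rfl⟩
  have hv : IsPosSol k A v := hy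
  have hv1 : v 1 ≠ 0 := (hy.pos 1).ne'
  have hbij := bijective_fderiv_defectMap (g := g) hA hg hv hc hcy
  have hcd := contDiffAt_defectMap k A g hv1
  have hn : ((⊤ : ℕ∞) : WithTop ℕ∞) ≠ 0 := by simp
  let L := ContinuousLinearEquiv.ofBijective (fderiv ℝ (defectMap k A g) v)
    (LinearMap.ker_eq_bot.2 hbij.1) (LinearMap.range_eq_top.2 hbij.2)
  have hL : HasFDerivAt (defectMap k A g) (L : (ℕ →ᵇ ℝ) →L[ℝ] (ℕ →ᵇ ℝ) × ℝ) v := by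
    rw [ContinuousLinearEquiv.coe_ofBijective]
    exact (hcd.differentiableAt hn).hasFDerivAt
  have hval : defectMap k A g v = (0, g * y 0 / y 1) := by
    refine Prod.ext ?_ rfl
    ext n
    have : v (n + 2) = _ := hv.step n
    simp [defectMap, this, mul_assoc]
  set G := hcd.localInverse hL hn with hG
  have hGcd : ContDiffAt ℝ ((⊤ : ℕ∞) : WithTop ℕ∞) G (0, g * y 0 / y 1) := by
    rw [← hval]
    exact hcd.to_localInverse hL hn
  have hGv : G (0, g * y 0 / y 1) = v := by
    rw [← hval]
    exact hcd.localInverse_apply_image hL hn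
  have hGr : ∀ᶠ z in 𝓝 ((0 : ℕ →ᵇ ℝ), g * y 0 / y 1), defectMap k A g (G z) = z := by
    rw [← hval]
    exact (hcd.hasStrictFDerivAt' hL hn).eventually_right_inverse
  have hι : ContDiff ℝ ((⊤ : ℕ∞) : WithTop ℕ∞) fun x : ℝ => ((0 : ℕ →ᵇ ℝ), x) :=
    contDiff_const.prodMk contDiff_id
  have hGι := ContDiffAt.comp (g * y 0 / y 1) hGcd hι.contDiffAt
  refine ⟨fun x => G (0, x), ?_, ?_⟩
  · exact (BoundedContinuousFunction.evalCLM ℝ 0).contDiff.contDiffAt.comp _ hGι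
  · have hnear : ∀ᶠ x in 𝓝 (g * y 0 / y 1), dist (G (0, x)) v < c / 2 := by
      have h : Tendsto (fun x => G (0, x)) (𝓝 (g * y 0 / y 1)) (𝓝 v) := by
        have := hGι.continuousAt.tendsto
        rwa [Function.comp_apply, hGv] at this
      exact h.eventually (Metric.ball_mem_nhds v (by positivity))
    filter_upwards [hnear, hι.continuous.continuousAt.eventually hGr] with x hx hx'
    have hd (n) : |G (0, x) n - y n| < c / 2 :=
      (BoundedContinuousFunction.dist_coe_le_dist n).trans_lt hx
    have hlow (n) : c / 2 ≤ G (0, x) n := by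
      have := abs_lt.1 (hd n)
      linarith [hcy n]
    refine ⟨⟨fun n => by linarith [hlow n], fun n => ?_⟩, congrArg Prod.snd hx', c / 2,
      ‖G (0, x)‖, by positivity, fun n => ⟨hlow n, ?_⟩⟩
    · have h1 : (defectMap k A g (G (0, x))).1 n = 0 := by rw [hx']; rfl
      simp only [defectMap] at h1
      simp at h1
      linarith
    · exact (le_abs_self _).trans ((G (0, x)).norm_coe_le_norm n)

/-! ### Orbits and equilibria -/

section Orbit

variable {α₁ A₁ γ₂ : ℝ} {p : ℝ × ℝ}

lemma orbit_succ (n : ℕ) : orbit α₁ A₁ γ₂ p (n + 1) = ratMap α₁ A₁ γ₂ (orbit α₁ A₁ γ₂ p n) :=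
  Function.iterate_succ_apply' _ _ _

lemma orbit_ratMap (n : ℕ) : orbit α₁ A₁ γ₂ (ratMap α₁ A₁ γ₂ p) n = orbit α₁ A₁ γ₂ p (n + 1) :=
  (Function.iterate_succ_apply _ _ _).symm

lemma orbit_fst_succ (n : ℕ) :
    (orbit α₁ A₁ γ₂ p (n + 1)).1 = α₁ / (A₁ + (orbit α₁ A₁ γ₂ p n).2) := by
  rw [orbit_succ, ratMap]

lemma orbit_snd_succ (n : ℕ) : (orbit α₁ A₁ γ₂ p (n + 1)).2 =
    γ₂ * (orbit α₁ A₁ γ₂ p n).2 / (orbit α₁ A₁ γ₂ p n).1 := by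
  rw [orbit_succ, ratMap]

lemma orbit_snd_one : (orbit α₁ A₁ γ₂ p 1).2 = γ₂ * p.2 / p.1 := rfl

lemma ratMap_mem_quadrant (hα : 0 < α₁) (hA : 0 < A₁) (hγ : 0 < γ₂)
    (hp : p ∈ Ioi (0 : ℝ) ×ˢ Ioi (0 : ℝ)) :
    ratMap α₁ A₁ γ₂ p ∈ Ioi (0 : ℝ) ×ˢ Ioi (0 : ℝ) := by
  obtain ⟨h1, h2⟩ := hp
  rw [mem_Ioi] at h1 h2
  constructor <;> simp only [ratMap, mem_Ioi] <;> positivity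

lemma orbit_pos (hα : 0 < α₁) (hA : 0 < A₁) (hγ : 0 < γ₂) (h1 : 0 < p.1) (h2 : 0 ≤ p.2) (n : ℕ) :
    0 < (orbit α₁ A₁ γ₂ p n).1 ∧ 0 ≤ (orbit α₁ A₁ γ₂ p n).2 := by
  induction n with
  | zero => exact ⟨h1, h2⟩
  | succ n ih =>
    obtain ⟨h1, h2⟩ := ih
    rw [orbit_fst_succ, orbit_snd_succ]
    constructor <;> positivity

lemma mem_admissible_iff (hα : 0 < α₁) (hA : 0 < A₁) (hγ : 0 < γ₂) :
    p ∈ admissible α₁ A₁ γ₂ ↔ 0 < p.1 ∧ 0 ≤ p.2 := by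
  constructor
  · rintro ⟨h1, h2, h⟩
    exact ⟨h1.lt_of_ne' (h 0).2, h2⟩
  · rintro ⟨h1, h2⟩
    refine ⟨h1.le, h2, fun n => ?_⟩
    have := orbit_pos hα hA hγ h1 h2 n
    exact ⟨by linarith, this.1.ne'⟩

/-- The second components of an orbit satisfy a second-order equation of their own, because
`x (n + 1)` is a function of `y n`. -/
lemma isPosSol_orbit (hα : 0 < α₁) (hA : 0 < A₁) (hγ : 0 < γ₂)
    (hp : p ∈ Ioi (0 : ℝ) ×ˢ Ioi (0 : ℝ)) :
    IsPosSol (γ₂ / α₁) A₁ fun n => (orbit α₁ A₁ γ₂ p n).2 := by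
  have hmem (n) : orbit α₁ A₁ γ₂ p n ∈ Ioi (0 : ℝ) ×ˢ Ioi (0 : ℝ) := by
    induction n with
    | zero => exact hp
    | succ n ih => rw [orbit_succ]; exact ratMap_mem_quadrant hα hA hγ ih
  refine ⟨fun n => (hmem n).2, fun n => ?_⟩
  have h : 0 < (orbit α₁ A₁ γ₂ p n).2 := (hmem n).2
  rw [orbit_snd_succ (n + 1), orbit_fst_succ]
  field_simp

/-- Every positive solution of the second-order equation comes from an orbit. -/
lemma IsPosSol.orbit_eq (hα : 0 < α₁) (hA : 0 < A₁) (hγ : 0 < γ₂) {y : ℕ → ℝ}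
    (hy : IsPosSol (γ₂ / α₁) A₁ y) :
    (fun n => (orbit α₁ A₁ γ₂ (γ₂ * y 0 / y 1, y 0) n).2) = y := by
  have h0 := hy.pos 0
  have h1 := hy.pos 1
  have hs := isPosSol_orbit (p := (γ₂ * y 0 / y 1, y 0)) hα hA hγ
    ⟨by simp only [mem_Ioi]; positivity, h0⟩
  have e0 : (orbit α₁ A₁ γ₂ (γ₂ * y 0 / y 1, y 0) 0).2 = y 0 := rfl
  have e1 : (orbit α₁ A₁ γ₂ (γ₂ * y 0 / y 1, y 0) 1).2 = y 1 := by
    rw [orbit_snd_one]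
    field_simp
  have hk : 0 < γ₂ / α₁ := by positivity
  exact funext fun n => le_antisymm (hs.mono hk hA hy e0.le e1.le n) (hy.mono hk hA hs e0.ge e1.ge n)

lemma tendsto_orbit {l : ℝ} (hl : A₁ + l ≠ 0)
    (h : Tendsto (fun n => (orbit α₁ A₁ γ₂ p n).2) atTop (𝓝 l)) :
    Tendsto (orbit α₁ A₁ γ₂ p) atTop (𝓝 (α₁ / (A₁ + l), l)) := by
  have h1 : Tendsto (fun n => (orbit α₁ A₁ γ₂ p n).1) atTop (𝓝 (α₁ / (A₁ + l))) := by
    rw [← tendsto_add_atTop_iff_nat 1]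
    simp only [orbit_fst_succ]
    exact tendsto_const_nhds.div (tendsto_const_nhds.add h) hl
  exact h1.prodMk_nhds h

lemma tendsToZeroInfty_of_tendsto (h : Tendsto (fun n => (orbit α₁ A₁ γ₂ p n).2) atTop atTop) :
    TendsToZeroInfty α₁ A₁ γ₂ p := by
  refine ⟨?_, h⟩
  rw [← tendsto_add_atTop_iff_nat 1]
  simp only [orbit_fst_succ]
  exact (tendsto_atTop_add_const_left _ _ h).const_div_atTop _

lemma orbit_snd_eq_zero (h : p.2 = 0) (n : ℕ) : (orbit α₁ A₁ γ₂ p n).2 = 0 := by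
  induction n with
  | zero => exact h
  | succ n ih => rw [orbit_snd_succ, ih]; simp

lemma tendsto_orbit_of_snd_eq_zero (hA : 0 < A₁) (h : p.2 = 0) :
    Tendsto (orbit α₁ A₁ γ₂ p) atTop (𝓝 (α₁ / A₁, 0)) := by
  have := tendsto_orbit (α₁ := α₁) (A₁ := A₁) (γ₂ := γ₂) (p := p) (l := 0) (by simpa using hA.ne')
    (by simp [orbit_snd_eq_zero h])
  simpa using this

lemma axis_mem_equilibria (hα : 0 < α₁) (hA : 0 < A₁) (hγ : 0 < γ₂) :
    (α₁ / A₁, 0) ∈ equilibria α₁ A₁ γ₂ :=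
  ⟨(mem_admissible_iff hα hA hγ).2 ⟨by positivity, le_rfl⟩, by simp [ratMap]⟩

lemma interior_mem_equilibria (hα : 0 < α₁) (hA : 0 < A₁) (hγ : 0 < γ₂) (h : A₁ < α₁ / γ₂) :
    (γ₂, α₁ / γ₂ - A₁) ∈ equilibria α₁ A₁ γ₂ := by
  refine ⟨(mem_admissible_iff hα hA hγ).2 ⟨hγ, by simp only; linarith⟩, ?_⟩
  simp only [ratMap, add_sub_cancel, Prod.mk.injEq]
  constructor <;> field_simp

lemma eq_of_mem_equilibria (hα : 0 < α₁) (hA : 0 < A₁) (hγ : 0 < γ₂)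
    (hp : p ∈ equilibria α₁ A₁ γ₂) :
    p = (α₁ / A₁, 0) ∨ p = (γ₂, α₁ / γ₂ - A₁) ∧ A₁ < α₁ / γ₂ := by
  obtain ⟨hadm, hfix⟩ := hp
  obtain ⟨h1, h2⟩ := (mem_admissible_iff hα hA hγ).1 hadm
  obtain ⟨x, y⟩ := p
  simp only [ratMap, Prod.mk.injEq] at hfix h1 h2
  obtain ⟨e1, e2⟩ := hfix
  rcases h2.eq_or_lt with rfl | hy
  · left
    rw [← e1, add_zero]
  · right
    have hx : x = γ₂ := by
      rw [div_eq_iff h1.ne', mul_comm] at e2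
      exact (mul_left_cancel₀ hy.ne' e2).symm
    subst hx
    have : y = α₁ / x - A₁ := by
      rw [← e1]
      field_simp
      ring
    exact ⟨by rw [← this], by linarith⟩

end Orbit

/-! ### Eigenvalues of the Jacobian -/

section Jacobian

/-- The eigenvalues of a planar Jacobian are determined by its trace and determinant. -/
lemma jacobianEigenvalues_eq {T : ℝ × ℝ → ℝ × ℝ} {z : ℝ × ℝ} {a b c d l m : ℝ}
    (h1 : fderiv ℝ T z (1, 0) = (a, c)) (h2 : fderiv ℝ T z (0, 1) = (b, d))
    (htr : l + m = a + d) (hdet : l * m = a * d - b * c) :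
    jacobianEigenvalues T z = {(l : ℂ), (m : ℂ)} := by
  have hM : LinearMap.toMatrix (Module.Basis.finTwoProd ℝ) (Module.Basis.finTwoProd ℝ)
      ((fderiv ℝ T z : ℝ × ℝ →L[ℝ] ℝ × ℝ) : ℝ × ℝ →ₗ[ℝ] ℝ × ℝ) = !![a, b; c, d] := by
    ext i j
    fin_cases i <;> fin_cases j <;> simp [LinearMap.toMatrix_apply, h1, h2]
  have hp : ((fderiv ℝ T z : ℝ × ℝ →L[ℝ] ℝ × ℝ) : ℝ × ℝ →ₗ[ℝ] ℝ × ℝ).charpoly =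
      (Polynomial.X - Polynomial.C l) * (Polynomial.X - Polynomial.C m) := by
    rw [← LinearMap.charpoly_toMatrix _ (Module.Basis.finTwoProd ℝ), hM, Matrix.charpoly_fin_two,
      Matrix.trace_fin_two_of, Matrix.det_fin_two_of, ← htr, ← hdet]
    simp only [map_add, map_mul]
    ring
  rw [jacobianEigenvalues, hp, Polynomial.aroots_mul, Polynomial.aroots_X_sub_C,
    Polynomial.aroots_X_sub_C]
  · rfl
  · exact mul_ne_zero (Polynomial.X_sub_C_ne_zero l) (Polynomial.X_sub_C_ne_zero m)

variable {α₁ A₁ γ₂ x y : ℝ}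

lemma contDiffAt_ratMap (hx : x ≠ 0) (hy : A₁ + y ≠ 0) :
    ContDiffAt ℝ 1 (ratMap α₁ A₁ γ₂) (x, y) := by
  refine ContDiffAt.prodMk ?_ ?_
  · exact contDiffAt_const.div (contDiffAt_const.add contDiffAt_snd) hy
  · exact (contDiffAt_const.mul contDiffAt_snd).div contDiffAt_fst hx

lemma fderiv_ratMap (hx : x ≠ 0) (hy : A₁ + y ≠ 0) :
    fderiv ℝ (ratMap α₁ A₁ γ₂) (x, y) (1, 0) = (0, -(γ₂ * y / x ^ 2)) ∧
      fderiv ℝ (ratMap α₁ A₁ γ₂) (x, y) (0, 1) = (-(α₁ / (A₁ + y) ^ 2), γ₂ / x) := by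
  have hf : HasFDerivAt (fun p : ℝ × ℝ => p.1) (ContinuousLinearMap.fst ℝ ℝ ℝ) (x, y) :=
    hasFDerivAt_fst
  have hs : HasFDerivAt (fun p : ℝ × ℝ => p.2) (ContinuousLinearMap.snd ℝ ℝ ℝ) (x, y) :=
    hasFDerivAt_snd
  have h1 := ((hasDerivAt_inv hy).comp_hasFDerivAt (x, y) (hs.const_add A₁)).const_mul α₁
  have h2 := (hs.const_mul γ₂).mul ((hasDerivAt_inv hx).comp_hasFDerivAt (x, y) hf)
  have h3 : HasFDerivAt (ratMap α₁ A₁ γ₂) _ (x, y) := (h1.prodMk h2).congr_of_eventuallyEq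
    (.of_forall fun w => Prod.ext (div_eq_mul_inv _ _) (div_eq_mul_inv _ _))
  rw [h3.fderiv]
  constructor <;> ext <;> simp <;> field_simp

lemma jacobianEigenvalues_axis (hα : 0 < α₁) (hA : 0 < A₁) :
    jacobianEigenvalues (ratMap α₁ A₁ γ₂) (α₁ / A₁, 0) =
      {((0 : ℝ) : ℂ), ((γ₂ / (α₁ / A₁) : ℝ) : ℂ)} := by
  obtain ⟨h1, h2⟩ := fderiv_ratMap (α₁ := α₁) (A₁ := A₁) (γ₂ := γ₂) (x := α₁ / A₁) (y := 0)
    (by positivity) (by simpa using hA.ne')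
  refine jacobianEigenvalues_eq h1 h2 ?_ ?_ <;> simp

lemma isSaddlePoint_axis (hα : 0 < α₁) (hA : 0 < A₁) (hγ : 0 < γ₂) (h : α₁ / A₁ < γ₂) :
    IsSaddlePoint (ratMap α₁ A₁ γ₂) (α₁ / A₁, 0) := by
  refine ⟨(axis_mem_equilibria hα hA hγ).2, contDiffAt_ratMap (by positivity) (by simpa using hA.ne'),
    _, _, jacobianEigenvalues_axis hα hA, by simp, ?_⟩
  rw [Complex.norm_real, Real.norm_of_nonneg (by positivity)]
  rwa [one_lt_div (by positivity)]

lemma isNonhyperbolic_axis (hα : 0 < α₁) (hA : 0 < A₁) (hγ : 0 < γ₂) (h : γ₂ = α₁ / A₁) :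
    IsNonhyperbolic (ratMap α₁ A₁ γ₂) (α₁ / A₁, 0) := by
  refine ⟨(axis_mem_equilibria hα hA hγ).2, contDiffAt_ratMap (by positivity) (by simpa using hA.ne'),
    ((γ₂ / (α₁ / A₁) : ℝ) : ℂ), by rw [jacobianEigenvalues_axis hα hA]; simp, ?_⟩
  rw [Complex.norm_real, ← h, div_self hγ.ne', norm_one]

/-- At the interior equilibrium the eigenvalues are the roots `(1 ± √(5 - 4θ)) / 2` of
`X² - X - (1 - θ)`, where `θ = γ₂ A₁ / α₁` lies in `(0, 1)`. -/
lemma isSaddlePoint_interior (hα : 0 < α₁) (hA : 0 < A₁) (hγ : 0 < γ₂) (h : A₁ < α₁ / γ₂) :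
    IsSaddlePoint (ratMap α₁ A₁ γ₂) (γ₂, α₁ / γ₂ - A₁) := by
  have hy : A₁ + (α₁ / γ₂ - A₁) = α₁ / γ₂ := by ring
  have hy0 : A₁ + (α₁ / γ₂ - A₁) ≠ 0 := by rw [hy]; positivity
  obtain ⟨h1, h2⟩ := fderiv_ratMap (α₁ := α₁) (γ₂ := γ₂) hγ.ne' hy0
  set θ := γ₂ * A₁ / α₁ with hθ
  have hθ0 : 0 < θ := by positivity
  have hθ1 : θ < 1 := by
    rw [lt_div_iff₀ hγ] at h
    rw [hθ, div_lt_one hα]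
    linarith
  set s := √(5 - 4 * θ) with hs
  have hss : s * s = 5 - 4 * θ := Real.mul_self_sqrt (by linarith)
  have hs1 : 1 < s := by rw [hs, Real.lt_sqrt (by norm_num)]; linarith
  have hs3 : s < 3 := by rw [hs, Real.sqrt_lt' (by norm_num)]; linarith
  refine ⟨(interior_mem_equilibria hα hA hγ h).2, contDiffAt_ratMap hγ.ne' hy0,
    (((1 - s) / 2 : ℝ) : ℂ), (((1 + s) / 2 : ℝ) : ℂ), jacobianEigenvalues_eq h1 h2 ?_ ?_, ?_, ?_⟩
  · field_simp
    ring
  · have e : (1 - s) / 2 * ((1 + s) / 2) = θ - 1 := by linear_combination (-1 / 4) * hss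
    rw [e, hθ, hy]
    field_simp
    ring
  · rw [Complex.norm_real, Real.norm_eq_abs, abs_lt]
    constructor <;> linarith
  · rw [Complex.norm_real, Real.norm_eq_abs, lt_abs]
    left
    linarith

end Jacobian

/-! ### The case of no interior equilibrium -/

section Large

variable {α₁ A₁ γ₂ : ℝ}

/-- If `γ₂ ≥ α₁ / A₁`, then off the horizontal axis `y` is nondecreasing and unbounded. -/
lemma tendsToZeroInfty_of_le (hα : 0 < α₁) (hA : 0 < A₁) (hγ : 0 < γ₂) (h : α₁ / A₁ ≤ γ₂)
    {p : ℝ × ℝ} (hp : p ∈ admissible α₁ A₁ γ₂) (hp' : p ∉ Ioi (0 : ℝ) ×ˢ {(0 : ℝ)}) :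
    TendsToZeroInfty α₁ A₁ γ₂ p := by
  obtain ⟨h1, h2⟩ := (mem_admissible_iff hα hA hγ).1 hp
  have h2' : 0 < p.2 := h2.lt_of_ne' fun h0 => hp' ⟨h1, h0⟩
  have hs := isPosSol_orbit hα hA hγ (p := p) ⟨h1, h2'⟩
  have hk : 0 < γ₂ / α₁ := by positivity
  have hkA : 1 ≤ γ₂ / α₁ * A₁ := by
    rw [div_le_iff₀ hA] at h
    rw [div_mul_eq_mul_div, one_le_div hα]
    exact h
  set y := fun n => (orbit α₁ A₁ γ₂ p n).2 with hy
  have hm : Monotone fun n => y (n + 1) := by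
    refine monotone_nat_of_le_succ fun n => ?_
    have e : y (n + 1 + 1) = γ₂ / α₁ * (A₁ + y n) * y (n + 1) := hs.step n
    rw [e]
    refine le_mul_of_one_le_left (hs.pos _).le (hkA.trans ?_)
    have := (hs.pos n).le
    gcongr
    linarith
  refine tendsToZeroInfty_of_tendsto (hs.tendsto_atTop_of_le hk (r := y 1) ?_ fun n => ?_)
  · have := mul_pos hk (hs.pos 1)
    rw [mul_add]
    linarith
  · exact hm (Nat.zero_le n)

lemma basin_axis_of_le (hα : 0 < α₁) (hA : 0 < A₁) (hγ : 0 < γ₂) (h : α₁ / A₁ ≤ γ₂) :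
    basin α₁ A₁ γ₂ (α₁ / A₁, 0) = Ioi (0 : ℝ) ×ˢ {(0 : ℝ)} := by
  ext p
  constructor
  · rintro ⟨hp, hlim⟩
    by_contra hp'
    have h1 := (tendsToZeroInfty_of_le hα hA hγ h hp hp').2
    exact not_tendsto_nhds_of_tendsto_atTop h1 _ ((continuous_snd.tendsto _).comp hlim)
  · rintro ⟨h1, h2⟩
    exact ⟨(mem_admissible_iff hα hA hγ).2 ⟨h1, (mem_singleton_iff.1 h2).ge⟩,
      tendsto_orbit_of_snd_eq_zero hA h2⟩

lemma equilibria_of_le (hα : 0 < α₁) (hA : 0 < A₁) (hγ : 0 < γ₂) (h : α₁ / A₁ ≤ γ₂) :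
    equilibria α₁ A₁ γ₂ = {(α₁ / A₁, 0)} := by
  refine Subset.antisymm (fun p hp => ?_) (singleton_subset_iff.2 (axis_mem_equilibria hα hA hγ))
  rcases eq_of_mem_equilibria hα hA hγ hp with h' | ⟨-, h'⟩
  · exact h'
  · rw [lt_div_iff₀ hγ] at h'
    rw [div_le_iff₀ hA] at h
    linarith

end Large

/-! ### Separation of the quadrant by a graph -/

/-- The graph of a continuous positive function on `(0, ∞)` separates the open quadrant into the
regions above and below it. -/
lemma isInvariantSeparatrix_graph {T : ℝ × ℝ → ℝ × ℝ} {C : ℝ → ℝ} (hC : ContinuousOn C (Ioi 0))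
    (hpos : MapsTo C (Ioi 0) (Ioi 0))
    (h0 : MapsTo T {p | p ∈ Ioi (0 : ℝ) ×ˢ Ioi (0 : ℝ) ∧ p.2 = C p.1}
      {p | p ∈ Ioi (0 : ℝ) ×ˢ Ioi (0 : ℝ) ∧ p.2 = C p.1})
    (h1 : MapsTo T {p | p ∈ Ioi (0 : ℝ) ×ˢ Ioi (0 : ℝ) ∧ p.2 > C p.1}
      {p | p ∈ Ioi (0 : ℝ) ×ˢ Ioi (0 : ℝ) ∧ p.2 > C p.1})
    (h2 : MapsTo T {p | p ∈ Ioi (0 : ℝ) ×ˢ Ioi (0 : ℝ) ∧ p.2 < C p.1}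
      {p | p ∈ Ioi (0 : ℝ) ×ˢ Ioi (0 : ℝ) ∧ p.2 < C p.1}) :
    IsInvariantSeparatrix T (Ioi (0 : ℝ) ×ˢ Ioi (0 : ℝ))
      {p | p ∈ Ioi (0 : ℝ) ×ˢ Ioi (0 : ℝ) ∧ p.2 = C p.1}
      {p | p ∈ Ioi (0 : ℝ) ×ˢ Ioi (0 : ℝ) ∧ p.2 > C p.1}
      {p | p ∈ Ioi (0 : ℝ) ×ˢ Ioi (0 : ℝ) ∧ p.2 < C p.1} := by
  set R : Set (ℝ × ℝ) := Ioi (0 : ℝ) ×ˢ Ioi (0 : ℝ) with hR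
  set S : Set (ℝ × ℝ) := {p | p ∈ R ∧ p.2 = C p.1} with hS
  set U : Set (ℝ × ℝ) := {p | p ∈ R ∧ p.2 > C p.1} with hU
  set V : Set (ℝ × ℝ) := {p | p ∈ R ∧ p.2 < C p.1} with hV
  have hRo : IsOpen R := isOpen_Ioi.prod isOpen_Ioi
  have hcont : ContinuousOn (fun p : ℝ × ℝ => p.2 - C p.1) R :=
    continuousOn_snd.sub (hC.comp continuousOn_fst fun p hp => hp.1)
  have hUo : IsOpen U := by
    have : U = R ∩ (fun p : ℝ × ℝ => p.2 - C p.1) ⁻¹' Ioi 0 := by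
      ext p; simp [hU]
    rw [this]
    exact hcont.isOpen_inter_preimage hRo isOpen_Ioi
  have hVo : IsOpen V := by
    have : V = R ∩ (fun p : ℝ × ℝ => p.2 - C p.1) ⁻¹' Iio 0 := by
      ext p; simp [hV]
    rw [this]
    exact hcont.isOpen_inter_preimage hRo isOpen_Iio
  have hdisj : Disjoint U V := disjoint_left.2 fun p hp hq => lt_asymm hp.2 hq.2
  have hdiff : R \ S = U ∪ V := by
    ext p
    constructor
    · rintro ⟨hp, hne⟩
      rcases lt_trichotomy p.2 (C p.1) with h | h | h
      · exact .inr ⟨hp, h⟩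
      · exact absurd ⟨hp, h⟩ hne
      · exact .inl ⟨hp, h⟩
    · rintro (h | h)
      · exact ⟨h.1, fun h' => h.2.ne' h'.2⟩
      · exact ⟨h.1, fun h' => h.2.ne h'.2⟩
  have hSU (p) (hp : p ∈ S) : p ∈ closure U := by
    obtain ⟨⟨hx, hy⟩, hpC⟩ := hp
    have hlim : Tendsto (fun t : ℝ => (p.1, p.2 + t)) (𝓝[>] 0) (𝓝 p) := by
      have : ContinuousAt (fun t : ℝ => (p.1, p.2 + t)) 0 := by fun_prop
      simpa using this.tendsto.mono_left nhdsWithin_le_nhds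
    refine mem_closure_of_tendsto hlim ?_
    filter_upwards [self_mem_nhdsWithin] with t ht
    rw [mem_Ioi] at ht hy
    exact ⟨⟨hx, add_pos hy ht⟩, by simp only; linarith⟩
  have hSV (p) (hp : p ∈ S) : p ∈ closure V := by
    obtain ⟨⟨hx, hy⟩, hpC⟩ := hp
    rw [mem_Ioi] at hy
    have hlim : Tendsto (fun t : ℝ => (p.1, p.2 - t)) (𝓝[>] 0) (𝓝 p) := by
      have : ContinuousAt (fun t : ℝ => (p.1, p.2 - t)) 0 := by fun_prop
      simpa using this.tendsto.mono_left nhdsWithin_le_nhds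
    refine mem_closure_of_tendsto hlim ?_
    filter_upwards [Ioo_mem_nhdsGT hy] with t ht
    exact ⟨⟨hx, sub_pos.2 ht.2⟩, by simp only; linarith [ht.1]⟩
  refine ⟨fun p hp => hp.1, h0, h1, h2, hUo, hVo, ?_, ?_, hdisj, hdiff, ?_, ?_⟩
  · -- the region above the graph is the image of the quadrant under `(x, t) ↦ (x, C x + t)`
    have : U = (fun p : ℝ × ℝ => (p.1, C p.1 + p.2)) '' R := by
      ext p
      constructor
      · rintro ⟨⟨hx, -⟩, h⟩
        exact ⟨(p.1, p.2 - C p.1), ⟨hx, sub_pos.2 h⟩, by simp⟩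
      · rintro ⟨q, ⟨hx, ht⟩, rfl⟩
        exact ⟨⟨hx, show 0 < C q.1 + q.2 from add_pos (hpos hx) ht⟩, lt_add_of_pos_right _ ht⟩
    rw [this]
    refine (isConnected_Ioi.prod isConnected_Ioi).image _ ?_
    exact continuousOn_fst.prodMk ((hC.comp continuousOn_fst fun p hp => hp.1).add continuousOn_snd)
  · -- the region below the graph is the image of a strip under `(x, t) ↦ (x, t * C x)`
    have : V = (fun p : ℝ × ℝ => (p.1, p.2 * C p.1)) '' (Ioi (0 : ℝ) ×ˢ Ioo (0 : ℝ) 1) := by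
      ext p
      constructor
      · rintro ⟨⟨hx, hy⟩, h⟩
        have hCp : 0 < C p.1 := hpos hx
        refine ⟨(p.1, p.2 / C p.1), ⟨hx, div_pos hy hCp, (div_lt_one hCp).2 h⟩, ?_⟩
        simp [div_mul_cancel₀ _ hCp.ne']
      · rintro ⟨q, ⟨hx, ht⟩, rfl⟩
        have hCq : 0 < C q.1 := hpos hx
        exact ⟨⟨hx, mul_pos ht.1 hCq⟩, mul_lt_of_lt_one_left hCq ht.2⟩
    rw [this]
    refine (isConnected_Ioi.prod (isConnected_Ioo zero_lt_one)).image _ ?_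
    exact continuousOn_fst.prodMk (continuousOn_snd.mul (hC.comp continuousOn_fst fun p hp => hp.1))
  · ext p
    rw [hUo.frontier_eq]
    constructor
    · rintro ⟨hp, hcl, hnU⟩
      by_contra hnS
      have hpV : p ∈ V := ((hdiff ▸ ⟨hp, hnS⟩ : p ∈ U ∪ V)).resolve_left hnU
      exact (hdisj.closure_left hVo).le_bot ⟨hcl, hpV⟩
    · exact fun hp => ⟨hp.1, hSU p hp, fun h => h.2.ne' hp.2⟩
  · ext p
    rw [hVo.frontier_eq]
    constructor
    · rintro ⟨hp, hcl, hnV⟩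
      by_contra hnS
      have hpU : p ∈ U := ((hdiff ▸ ⟨hp, hnS⟩ : p ∈ U ∪ V)).resolve_right hnV
      exact (hdisj.closure_right hUo).le_bot ⟨hpU, hcl⟩
    · exact fun hp => ⟨hp.1, hSV p hp, fun h => h.2.ne hp.2⟩

/-! ### The case of an interior equilibrium -/

section Small

variable {α₁ A₁ γ₂ : ℝ}

/-- The second component of the interior equilibrium is a fixed point of the recurrence. -/
lemma coeff_mul_eq_one (hα : 0 < α₁) (hγ : 0 < γ₂) :
    γ₂ / α₁ * (A₁ + (α₁ / γ₂ - A₁)) = 1 := by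
  field_simp
  ring

lemma isLocallyAsymptoticallyStable_axis (hα : 0 < α₁) (hA : 0 < A₁) (hγ : 0 < γ₂)
    (h : γ₂ < α₁ / A₁) : IsLocallyAsymptoticallyStable α₁ A₁ γ₂ (α₁ / A₁, 0) := by
  have hk : 0 < γ₂ / α₁ := by positivity
  have hke := coeff_mul_eq_one (A₁ := A₁) hα hγ
  set e := α₁ / γ₂ - A₁ with he_def
  have he : 0 < e := by
    rw [he_def, sub_pos, lt_div_iff₀ hγ]
    rw [lt_div_iff₀ hA] at h
    linarith
  -- close to the equilibrium `x 0 > γ₂`, hence `y 1 ≤ y 0`, and `y` stays below `y 0`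
  set d := min (α₁ / A₁ - γ₂) e with hd
  have hd0 : 0 < d := lt_min (sub_pos.2 h) he
  have hstart {p : ℝ × ℝ} (hp : p ∈ admissible α₁ A₁ γ₂) (hd : dist p (α₁ / A₁, 0) < d) :
      0 < p.1 ∧ 0 ≤ p.2 ∧ p.2 < e ∧ (orbit α₁ A₁ γ₂ p 1).2 ≤ p.2 := by
    obtain ⟨h1, h2⟩ := (mem_admissible_iff hα hA hγ).1 hp
    rw [Prod.dist_eq, max_lt_iff, Real.dist_eq, Real.dist_eq, sub_zero, abs_lt,
      abs_of_nonneg h2] at hd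
    have hx : γ₂ ≤ p.1 := by
      have := hd.1.1
      have := min_le_left (α₁ / A₁ - γ₂) e
      linarith
    refine ⟨h1, h2, hd.2.trans_le (min_le_right _ _), ?_⟩
    rw [orbit_snd_one, div_le_iff₀ h1]
    nlinarith
  have hbound {p : ℝ × ℝ} (hp : p ∈ admissible α₁ A₁ γ₂) (hd : dist p (α₁ / A₁, 0) < d) (n : ℕ) :
      0 ≤ (orbit α₁ A₁ γ₂ p n).2 ∧ (orbit α₁ A₁ γ₂ p n).2 ≤ p.2 := by
    obtain ⟨h1, h2, h3, h4⟩ := hstart hp hd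
    rcases h2.eq_or_lt with h0 | h0
    · rw [orbit_snd_eq_zero h0.symm, ← h0]
      simp
    · have hs := isPosSol_orbit hα hA hγ (p := p) ⟨h1, h0⟩
      refine ⟨(hs.pos n).le, ?_⟩
      suffices H : (orbit α₁ A₁ γ₂ p n).2 ≤ p.2 ∧ (orbit α₁ A₁ γ₂ p (n + 1)).2 ≤ p.2 from H.1
      induction n with
      | zero => exact ⟨le_rfl, h4⟩
      | succ n ih =>
        refine ⟨ih.2, ?_⟩
        have e1 := hs.step n
        beta_reduce at e1
        have hle : γ₂ / α₁ * (A₁ + (orbit α₁ A₁ γ₂ p n).2) ≤ 1 := by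
          rw [← hke]
          gcongr
          exact ih.1.trans h3.le
        exact e1.trans_le ((mul_le_of_le_one_left (hs.pos (n + 1)).le hle).trans ih.2)
  refine ⟨axis_mem_equilibria hα hA hγ, fun ε hε => ?_, d, hd0, fun p hp hpd => ?_⟩
  · refine ⟨min d (min ε (ε * A₁ ^ 2 / α₁)), by positivity, fun p hp hpd n => ?_⟩
    obtain ⟨hpd, hpε⟩ := lt_min_iff.1 hpd
    obtain ⟨hpε, hpε'⟩ := lt_min_iff.1 hpε
    have h2 : p.2 ≤ dist p (α₁ / A₁, 0) := by
      rw [Prod.dist_eq, Real.dist_eq p.2, sub_zero]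
      exact (le_abs_self _).trans (le_max_right _ _)
    cases n with
    | zero => exact hpε
    | succ n =>
      obtain ⟨hy0, hy⟩ := hbound hp hpd n
      obtain ⟨hy0', hy'⟩ := hbound hp hpd (n + 1)
      rw [Prod.dist_eq, max_lt_iff, Real.dist_eq, Real.dist_eq, sub_zero, abs_of_nonneg hy0']
      refine ⟨?_, by linarith⟩
      set y := (orbit α₁ A₁ γ₂ p n).2
      have e1 : (orbit α₁ A₁ γ₂ p (n + 1)).1 - α₁ / A₁ = -(α₁ * y / (A₁ * (A₁ + y))) := by
        have : A₁ + y ≠ 0 := by positivity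
        rw [orbit_fst_succ]
        change α₁ / (A₁ + y) - α₁ / A₁ = _
        field_simp
        ring
      rw [e1, abs_neg, abs_of_nonneg (by positivity), div_lt_iff₀ (by positivity)]
      have h3 : y < ε * A₁ ^ 2 / α₁ := by linarith
      rw [lt_div_iff₀ hα] at h3
      have : 0 ≤ ε * A₁ * y := by positivity
      nlinarith
  · obtain ⟨h1, h2, h3, h4⟩ := hstart hp hpd
    rcases h2.eq_or_lt with h0 | h0
    · exact tendsto_orbit_of_snd_eq_zero hA h0.symm
    · have hs := isPosSol_orbit hα hA hγ (p := p) ⟨h1, h0⟩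
      have := tendsto_orbit (α₁ := α₁) (by simpa using hA.ne')
        (hs.tendsto_zero hk hA he hke h3.le (h4.trans h3.le) (.inl h3))
      simpa using this

lemma continuousAt_orbit (hα : 0 < α₁) (hA : 0 < A₁) (hγ : 0 < γ₂) {p : ℝ × ℝ}
    (h1 : 0 < p.1) (h2 : 0 ≤ p.2) (n : ℕ) :
    ContinuousAt (fun p => orbit α₁ A₁ γ₂ p n) p := by
  induction n with
  | zero => exact continuousAt_id
  | succ n ih =>
    simp only [orbit_succ]
    have hpos := orbit_pos hα hA hγ h1 h2 n
    have h : ContinuousAt (ratMap α₁ A₁ γ₂) (orbit α₁ A₁ γ₂ p n) :=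
      (contDiffAt_ratMap hpos.1.ne' (add_pos_of_pos_of_nonneg hA hpos.2).ne').continuousAt
    exact ContinuousAt.comp (f := fun p => orbit α₁ A₁ γ₂ p n) h ih

/-- On each vertical half-line, the points whose orbits go to `0` and those whose orbits go to `∞`
form disjoint nonempty open sets. As the half-line is connected, some orbit does neither. -/
lemma exists_tendsto_equilibrium (hα : 0 < α₁) (hA : 0 < A₁) (hγ : 0 < γ₂) {e : ℝ} (he : 0 < e)
    (hke : γ₂ / α₁ * (A₁ + e) = 1) {x : ℝ} (hx : 0 < x) :
    ∃ y, 0 < y ∧ Tendsto (fun n => (orbit α₁ A₁ γ₂ (x, y) n).2) atTop (𝓝 e) := by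
  have hk : 0 < γ₂ / α₁ := by positivity
  have hs {y : ℝ} (hy : 0 < y) := isPosSol_orbit (p := (x, y)) hα hA hγ ⟨hx, hy⟩
  have hcont {y : ℝ} (hy : 0 < y) (n : ℕ) :
      ContinuousAt (fun y => (orbit α₁ A₁ γ₂ (x, y) n).2) y := by
    have h1 := continuousAt_orbit (p := (x, y)) hα hA hγ hx hy.le n
    have h2 : ContinuousAt (fun y : ℝ => (x, y)) y := by fun_prop
    exact continuousAt_snd.comp (ContinuousAt.comp (f := fun y : ℝ => (x, y)) h1 h2)
  set D : Set ℝ := {y | 0 < y ∧ ∃ n, (orbit α₁ A₁ γ₂ (x, y) n).2 < e ∧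
    (orbit α₁ A₁ γ₂ (x, y) (n + 1)).2 < e} with hD
  set I : Set ℝ := {y | 0 < y ∧ ∃ n, e < (orbit α₁ A₁ γ₂ (x, y) n).2 ∧
    e < (orbit α₁ A₁ γ₂ (x, y) (n + 1)).2} with hI
  have hDo : IsOpen D := by
    rw [isOpen_iff_mem_nhds]
    rintro y ⟨hy, n, h1, h2⟩
    filter_upwards [lt_mem_nhds hy, (hcont hy n).eventually (gt_mem_nhds h1),
      (hcont hy (n + 1)).eventually (gt_mem_nhds h2)] with z hz h1 h2
    exact ⟨hz, n, h1, h2⟩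
  have hIo : IsOpen I := by
    rw [isOpen_iff_mem_nhds]
    rintro y ⟨hy, n, h1, h2⟩
    filter_upwards [lt_mem_nhds hy, (hcont hy n).eventually (lt_mem_nhds h1),
      (hcont hy (n + 1)).eventually (lt_mem_nhds h2)] with z hz h1 h2
    exact ⟨hz, n, h1, h2⟩
  by_contra! hno
  have hcover : Ioi (0 : ℝ) ⊆ D ∪ I := by
    intro y hy
    rw [mem_Ioi] at hy
    rcases (hs hy).trichotomy hk hA he hke with h | h | h
    · left
      obtain ⟨n, h1, h2⟩ := ((h.eventually (gt_mem_nhds he)).and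
        (((tendsto_add_atTop_iff_nat 1).2 h).eventually (gt_mem_nhds he))).exists
      exact ⟨hy, n, h1, h2⟩
    · right
      obtain ⟨n, h1, h2⟩ := ((h.eventually (eventually_gt_atTop e)).and
        (((tendsto_add_atTop_iff_nat 1).2 h).eventually (eventually_gt_atTop e))).exists
      exact ⟨hy, n, h1, h2⟩
    · exact absurd h (hno y hy)
  have hDne : (Ioi (0 : ℝ) ∩ D).Nonempty := by
    have hy : 0 < min (e / 2) (e * x / (2 * γ₂)) := by positivity
    refine ⟨_, hy, hy, 0, ?_, ?_⟩
    · exact (min_le_left _ _).trans_lt (half_lt_self he)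
    · rw [zero_add, orbit_snd_one, div_lt_iff₀ hx]
      calc γ₂ * min (e / 2) (e * x / (2 * γ₂)) ≤ γ₂ * (e * x / (2 * γ₂)) := by
            gcongr
            exact min_le_right _ _
        _ = e * x / 2 := by field_simp
        _ < e * x := half_lt_self (by positivity)
  have hIne : (Ioi (0 : ℝ) ∩ I).Nonempty := by
    have hy : 0 < max (2 * e) (2 * (e * x) / γ₂) := by positivity
    refine ⟨_, hy, hy, 0, ?_, ?_⟩
    · exact (show e < 2 * e by linarith).trans_le (le_max_left _ _)
    · rw [zero_add, orbit_snd_one, lt_div_iff₀ hx]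
      calc e * x < 2 * (e * x) := by linarith [mul_pos he hx]
        _ = γ₂ * (2 * (e * x) / γ₂) := by field_simp
        _ ≤ γ₂ * max (2 * e) (2 * (e * x) / γ₂) := by
            gcongr
            exact le_max_right _ _
  obtain ⟨y, hy, ⟨-, n, h1, h2⟩, -, m, h3, h4⟩ :=
    isPreconnected_Ioi D I hDo hIo hcover hDne hIne
  -- no orbit goes both to `0` and to `∞`
  have ht0 := ((hs hy).shift n).tendsto_zero hk hA he hke (by simpa using h1.le)
    (by simpa [add_comm] using h2.le) (.inl (by simpa using h1))
  have ht1 := ((hs hy).shift m).tendsto_atTop hk hA he hke (by simpa using h3.le)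
    (by simpa [add_comm] using h4.le) (.inl (by simpa using h3))
  rw [tendsto_add_atTop_iff_nat (f := fun n => (orbit α₁ A₁ γ₂ (x, y) n).2)] at ht0 ht1
  exact not_tendsto_nhds_of_tendsto_atTop ht1 _ ht0

/-- The stable manifold of the interior equilibrium is the graph of a smooth increasing function,
and the side of the graph decides the fate of an orbit. -/
lemma exists_stable_graph (hα : 0 < α₁) (hA : 0 < A₁) (hγ : 0 < γ₂) {e : ℝ} (he : 0 < e)
    (hke : γ₂ / α₁ * (A₁ + e) = 1) :
    ∃ C : ℝ → ℝ, MapsTo C (Ioi 0) (Ioi 0) ∧ StrictMonoOn C (Ioi 0) ∧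
      ContDiffOn ℝ ((⊤ : ℕ∞) : WithTop ℕ∞) C (Ioi 0) ∧
      ∀ p ∈ Ioi (0 : ℝ) ×ˢ Ioi (0 : ℝ),
        (p.2 > C p.1 ↔ Tendsto (fun n => (orbit α₁ A₁ γ₂ p n).2) atTop atTop) ∧
        (p.2 = C p.1 ↔ Tendsto (fun n => (orbit α₁ A₁ γ₂ p n).2) atTop (𝓝 e)) ∧
        (p.2 < C p.1 ↔ Tendsto (fun n => (orbit α₁ A₁ γ₂ p n).2) atTop (𝓝 0)) := by
  have hk : 0 < γ₂ / α₁ := by positivity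
  have hex (x : ℝ) (hx : 0 < x) := exists_tendsto_equilibrium hα hA hγ he hke hx
  choose! C hC0 hC using hex
  have hs {p : ℝ × ℝ} (h1 : 0 < p.1) (h2 : 0 < p.2) :=
    isPosSol_orbit (p := p) hα hA hγ ⟨h1, h2⟩
  -- moving up and to the left increases the second components of an orbit
  have hfst {p p' : ℝ × ℝ} (hp' : 0 < p'.1) (h2 : 0 < p.2) (h : p'.1 ≤ p.1)
      (h' : p.2 ≤ p'.2) : (orbit α₁ A₁ γ₂ p 1).2 ≤ (orbit α₁ A₁ γ₂ p' 1).2 := by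
    have := h2.trans_le h'
    rw [orbit_snd_one, orbit_snd_one]
    gcongr
  have hgt {p : ℝ × ℝ} (h1 : 0 < p.1) (h : C p.1 < p.2) :
      Tendsto (fun n => (orbit α₁ A₁ γ₂ p n).2) atTop atTop :=
    (hs (p := (p.1, C p.1)) h1 (hC0 _ h1)).tendsto_atTop_of_lt hk hA he hke
      (hs h1 ((hC0 _ h1).trans h)) h.le (hfst h1 (hC0 _ h1) le_rfl h.le) (.inl h) (hC _ h1)
  have hlt {p : ℝ × ℝ} (h1 : 0 < p.1) (h2 : 0 < p.2) (h : p.2 < C p.1) :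
      Tendsto (fun n => (orbit α₁ A₁ γ₂ p n).2) atTop (𝓝 0) :=
    (hs h1 h2).tendsto_zero_of_lt hk hA he hke
      (hs (p := (p.1, C p.1)) h1 (hC0 _ h1)) h.le (hfst h1 h2 le_rfl h.le) (.inl h) (hC _ h1)
  have heq {p : ℝ × ℝ} (h1 : 0 < p.1) (h : p.2 = C p.1) :
      Tendsto (fun n => (orbit α₁ A₁ γ₂ p n).2) atTop (𝓝 e) := by
    have := hC _ h1
    rwa [← h] at this
  have hchar {p : ℝ × ℝ} (h1 : 0 < p.1) (h2 : 0 < p.2)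
      (h : Tendsto (fun n => (orbit α₁ A₁ γ₂ p n).2) atTop (𝓝 e)) : p.2 = C p.1 := by
    rcases lt_trichotomy p.2 (C p.1) with h' | h' | h'
    · exact absurd (tendsto_nhds_unique h (hlt h1 h2 h')) he.ne'
    · exact h'
    · exact absurd h (not_tendsto_nhds_of_tendsto_atTop (hgt h1 h') _)
  refine ⟨C, fun x hx => hC0 x hx, ?_, ?_, ?_⟩
  · intro x hx x' hx' hxx
    rw [mem_Ioi] at hx hx'
    by_contra! hle
    have hx0 := hC0 x hx
    have hx0' := hC0 x' hx'
    refine not_tendsto_nhds_of_tendsto_atTop ?_ _ (hC x hx)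
    refine (hs (p := (x', C x')) hx' hx0').tendsto_atTop_of_lt hk hA he hke
      (hs (p := (x, C x)) hx hx0) hle (hfst hx hx0' hxx.le hle) (.inr ?_) (hC x' hx')
    rw [orbit_snd_one, orbit_snd_one]
    calc γ₂ * C x' / x' < γ₂ * C x' / x := by gcongr
      _ ≤ γ₂ * C x / x := by gcongr
  · intro x₀ hx₀
    rw [mem_Ioi] at hx₀
    have hx0 := hC0 x₀ hx₀
    obtain ⟨Y, hY, hYev⟩ :=
      (hs (p := (x₀, C x₀)) hx₀ hx0).exists_smooth_family hA hγ he (hC x₀ hx₀)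
    have e1 : γ₂ * (orbit α₁ A₁ γ₂ (x₀, C x₀) 0).2 / (orbit α₁ A₁ γ₂ (x₀, C x₀) 1).2 = x₀ := by
      have e0 : (orbit α₁ A₁ γ₂ (x₀, C x₀) 0).2 = C x₀ := rfl
      rw [orbit_snd_one, e0]
      field_simp
    rw [e1] at hY hYev
    refine (hY.congr_of_eventuallyEq ?_).contDiffWithinAt
    filter_upwards [hYev] with x hx
    obtain ⟨hsol, hval, c, M, hc, hb⟩ := hx
    -- a solution that is bounded and bounded away from `0` can only converge to `e`
    have hlim : Tendsto (Y x) atTop (𝓝 e) := by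
      rcases hsol.trichotomy hk hA he hke with h | h | h
      · linarith [ge_of_tendsto' h fun n => (hb n).1]
      · obtain ⟨n, hn⟩ := (h.eventually (eventually_gt_atTop M)).exists
        linarith [(hb n).2]
      · exact h
    have horb := hsol.orbit_eq hα hA hγ
    rw [hval] at horb
    have h0 := hsol.pos 0
    have h1 := hsol.pos 1
    have hx0 : 0 < x := by rw [← hval]; positivity
    rw [← horb] at hlim
    exact (hchar (p := (x, Y x 0)) hx0 h0 hlim).symm
  · rintro p ⟨h1, h2⟩
    rw [mem_Ioi] at h1 h2
    refine ⟨⟨hgt h1, fun h => ?_⟩, ⟨heq h1, hchar h1 h2⟩, ⟨hlt h1 h2, fun h => ?_⟩⟩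
    · by_contra! hle
      rcases hle.eq_or_lt with h' | h'
      · exact not_tendsto_nhds_of_tendsto_atTop h _ (heq h1 h')
      · exact not_tendsto_nhds_of_tendsto_atTop h _ (hlt h1 h2 h')
    · by_contra! hle
      rcases hle.eq_or_lt with h' | h'
      · exact he.ne (tendsto_nhds_unique h (heq h1 h'.symm))
      · exact not_tendsto_nhds_of_tendsto_atTop (hgt h1 h') _ h

end Small

theorem theorem5 (α₁ A₁ γ₂ : ℝ) (hα : 0 < α₁) (hA : 0 < A₁) (hγ : 0 < γ₂) :
    (γ₂ > α₁ / A₁ →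
      equilibria α₁ A₁ γ₂ = {(α₁ / A₁, 0)} ∧
      IsSaddlePoint (ratMap α₁ A₁ γ₂) (α₁ / A₁, 0) ∧
      basin α₁ A₁ γ₂ (α₁ / A₁, 0) = Ioi (0 : ℝ) ×ˢ {(0 : ℝ)} ∧
      ∀ p ∈ admissible α₁ A₁ γ₂, p ∉ Ioi (0 : ℝ) ×ˢ {(0 : ℝ)} →
        TendsToZeroInfty α₁ A₁ γ₂ p) ∧
    (γ₂ = α₁ / A₁ →
      equilibria α₁ A₁ γ₂ = {(α₁ / A₁, 0)} ∧
      IsNonhyperbolic (ratMap α₁ A₁ γ₂) (α₁ / A₁, 0) ∧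
      basin α₁ A₁ γ₂ (α₁ / A₁, 0) = Ioi (0 : ℝ) ×ˢ {(0 : ℝ)} ∧
      ∀ p ∈ admissible α₁ A₁ γ₂, p ∉ Ioi (0 : ℝ) ×ˢ {(0 : ℝ)} →
        TendsToZeroInfty α₁ A₁ γ₂ p) ∧
    (γ₂ < α₁ / A₁ →
      equilibria α₁ A₁ γ₂ = {(α₁ / A₁, 0), (γ₂, α₁ / γ₂ - A₁)} ∧
      ((α₁ / A₁, 0) : ℝ × ℝ) ≠ (γ₂, α₁ / γ₂ - A₁) ∧
      IsLocallyAsymptoticallyStable α₁ A₁ γ₂ (α₁ / A₁, 0) ∧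
      IsSaddlePoint (ratMap α₁ A₁ γ₂) (γ₂, α₁ / γ₂ - A₁) ∧
      ∃ C : ℝ → ℝ,
        MapsTo C (Ioi 0) (Ioi 0) ∧
        StrictMonoOn C (Ioi 0) ∧
        ContDiffOn ℝ ((⊤ : ℕ∞) : WithTop ℕ∞) C (Ioi 0) ∧
        basin α₁ A₁ γ₂ (γ₂, α₁ / γ₂ - A₁) =
          {p | p ∈ Ioi (0 : ℝ) ×ˢ Ioi (0 : ℝ) ∧ p.2 = C p.1} ∧
        IsInvariantSeparatrix (ratMap α₁ A₁ γ₂) (Ioi (0 : ℝ) ×ˢ Ioi (0 : ℝ))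
          {p | p ∈ Ioi (0 : ℝ) ×ˢ Ioi (0 : ℝ) ∧ p.2 = C p.1}
          {p | p ∈ Ioi (0 : ℝ) ×ˢ Ioi (0 : ℝ) ∧ p.2 > C p.1}
          {p | p ∈ Ioi (0 : ℝ) ×ˢ Ioi (0 : ℝ) ∧ p.2 < C p.1} ∧
        ∀ p ∈ admissible α₁ A₁ γ₂,
          (p.2 > C p.1 → TendsToZeroInfty α₁ A₁ γ₂ p) ∧
          (p.2 = C p.1 →
            Tendsto (orbit α₁ A₁ γ₂ p) atTop (𝓝 (γ₂, α₁ / γ₂ - A₁))) ∧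
          (p.2 < C p.1 →
            Tendsto (orbit α₁ A₁ γ₂ p) atTop (𝓝 (α₁ / A₁, 0)))) := by
  refine ⟨fun h => ?_, fun h => ?_, fun h => ?_⟩
  · exact ⟨equilibria_of_le hα hA hγ h.le, isSaddlePoint_axis hα hA hγ h,
      basin_axis_of_le hα hA hγ h.le, fun p => tendsToZeroInfty_of_le hα hA hγ h.le⟩
  · exact ⟨equilibria_of_le hα hA hγ h.ge, isNonhyperbolic_axis hα hA hγ h,
      basin_axis_of_le hα hA hγ h.ge, fun p => tendsToZeroInfty_of_le hα hA hγ h.ge⟩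
  have hAlt : A₁ < α₁ / γ₂ := by
    rw [lt_div_iff₀ hγ]
    rw [lt_div_iff₀ hA] at h
    linarith
  have he : 0 < α₁ / γ₂ - A₁ := sub_pos.2 hAlt
  refine ⟨?_, ?_, isLocallyAsymptoticallyStable_axis hα hA hγ h,
    isSaddlePoint_interior hα hA hγ hAlt, ?_⟩
  · ext p
    constructor
    · exact fun hp => (eq_of_mem_equilibria hα hA hγ hp).imp id And.left
    · rintro (rfl | rfl)
      · exact axis_mem_equilibria hα hA hγ
      · exact interior_mem_equilibria hα hA hγ hAlt
  · exact fun heq => he.ne (congrArg Prod.snd heq)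
  obtain ⟨C, hC0, hCmono, hCsmooth, hC⟩ :=
    exists_stable_graph hα hA hγ he (coeff_mul_eq_one hα hγ)
  have hlim {p : ℝ × ℝ}
      (hp : Tendsto (fun n => (orbit α₁ A₁ γ₂ p n).2) atTop (𝓝 (α₁ / γ₂ - A₁))) :
      Tendsto (orbit α₁ A₁ γ₂ p) atTop (𝓝 (γ₂, α₁ / γ₂ - A₁)) := by
    have := tendsto_orbit (by linarith) hp
    rwa [add_sub_cancel, div_div_cancel₀ hα.ne'] at this
  -- the limit behaviour is the same along the orbit, so each of the three sets is invariant
  have hshift {p : ℝ × ℝ} {F : Filter ℝ}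
      (hp : Tendsto (fun n => (orbit α₁ A₁ γ₂ p n).2) atTop F) :
      Tendsto (fun n => (orbit α₁ A₁ γ₂ (ratMap α₁ A₁ γ₂ p) n).2) atTop F := by
    simp only [orbit_ratMap]
    exact (tendsto_add_atTop_iff_nat 1).2 hp
  have hT {p : ℝ × ℝ} (hp : p ∈ Ioi (0 : ℝ) ×ˢ Ioi (0 : ℝ)) :=
    ratMap_mem_quadrant hα hA hγ hp
  refine ⟨C, hC0, hCmono, hCsmooth, ?_, ?_, ?_⟩
  · ext p
    constructor
    · rintro ⟨hadm, hp⟩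
      obtain ⟨h1, h2⟩ := (mem_admissible_iff hα hA hγ).1 hadm
      have hp2 := (continuous_snd.tendsto _).comp hp
      rcases h2.eq_or_lt with h0 | h0
      · have h3 := (continuous_snd.tendsto _).comp
          (tendsto_orbit_of_snd_eq_zero (α₁ := α₁) (γ₂ := γ₂) hA h0.symm)
        exact absurd (tendsto_nhds_unique hp2 h3) he.ne'
      · exact ⟨⟨h1, h0⟩, (hC p ⟨h1, h0⟩).2.1.2 hp2⟩
    · rintro ⟨hp, hpC⟩
      exact ⟨(mem_admissible_iff hα hA hγ).2 ⟨hp.1, (mem_Ioi.1 hp.2).le⟩,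
        hlim ((hC p hp).2.1.1 hpC)⟩
  · refine isInvariantSeparatrix_graph hCsmooth.continuousOn hC0 ?_ ?_ ?_
    · exact fun p hp => ⟨hT hp.1, (hC _ (hT hp.1)).2.1.2 (hshift ((hC p hp.1).2.1.1 hp.2))⟩
    · exact fun p hp => ⟨hT hp.1, (hC _ (hT hp.1)).1.2 (hshift ((hC p hp.1).1.1 hp.2))⟩
    · exact fun p hp => ⟨hT hp.1, (hC _ (hT hp.1)).2.2.2 (hshift ((hC p hp.1).2.2.1 hp.2))⟩
  · intro p hadm
    obtain ⟨h1, h2⟩ := (mem_admissible_iff hα hA hγ).1 hadm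
    have hCp : 0 < C p.1 := hC0 h1
    refine ⟨fun h => ?_, fun h => ?_, fun h => ?_⟩
    · exact tendsToZeroInfty_of_tendsto ((hC p ⟨h1, hCp.trans h⟩).1.1 h)
    · exact hlim ((hC p ⟨h1, hCp.trans_eq h.symm⟩).2.1.1 h)
    · rcases h2.eq_or_lt with h0 | h0
      · exact tendsto_orbit_of_snd_eq_zero hA h0.symm
      · have := tendsto_orbit (α₁ := α₁) (by simpa using hA.ne') ((hC p ⟨h1, h0⟩).2.2.1 h)
        simpa using this
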